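/- Let $\widehat g:\mathbb R\to\mathbb R$ be one of the following spectral filters. * fOU: $\widehat g(x)=\sigma\sqrt{\Gamma(2d+2)\sin(\pi(d+\tfrac12))}\,(\zeta^2+x^2)^{-1/2}|x|^{-d}$ with $\sigma,\zeta>0$ and $-\tfrac12<d<\tfrac12$. * fGLE: $\widehat g(x)=c\,(\gamma_0+\gamma_1|x|^{\beta}+\gamma_2|x|^{2\beta})^{-1/2}|x|^{d}$ with $0<d<\tfrac12$, $\beta=1+2d$, $\gamma_0=a^2+b^2$, $\gamma_1=2bm$, $\gamma_2=m^2$, $a=\zeta\Gamma(2d+2)\sin(\pi(d+\tfrac12))$, $b=\zeta\Gamma(2d+2)\cos(\pi(d+\tfrac12))$, $c=\sqrt{2\zeta k_B\tau\,\Gamma(2d+2)\sin(\pi(d+\tfrac12))}$, where $m,\zeta,k_B,\tau>0$. Let $\widetilde B$ be a centered complex Gaussian random measure on $\mathbb R$ with $\widetilde B(-A)=\overline{\widetilde B(A)}$ a.s. and $E|\widetilde B(dx)|^2=dx$, and let the velocity process be $V(t)=\int_{\mathbb R}e^{itx}\widehat g(x)\,\widetilde B(dx)$, $t\ge0$. Let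 $\widehat u$ be a Meyer low-pass conjugate mirror filter: real, even, $2\pi$-periodic, $C^2$, equal to $\sqrt2$ on $|x|\le\pi/3$ and to $0$ on $2\pi/3\le|x|\le\pi$, with $\widehat u(x)^2+\widehat u(x+\pi)^2=2$. Put $\widehat v(x)=e^{-ix}\widehat u(x+\pi)$, $\widehat\phi(x)=2^{-1/2}\widehat u(x/2)1_{\{|x|\le4\pi/3\}}$ and $\widehat\psi(x)=2^{-1/2}\widehat v(x/2)\widehat\phi(x/2)$. The associated white noise sequences are $$\xi_k=\tfrac1{\sqrt{2\pi}}\int_{\mathbb R} e^{ikx}\widehat\phi(x)\widetilde B(dx),\qquad \varepsilon_{j,k}=\tfrac{2^{-j/2}}{\sqrt{2\pi}}\int_{\mathbb R} e^{i2^{-j}kx}\,\overline{\widehat\psi(2^{-j}x)}\,\widetilde B(dx),\qquad j\ge0,\ k\in\mathbb Z.$$ For $j\ge0$ let the truncated discretization filter $\widehat g_j$ be the $2\pi$-periodic extension of $\sqrt{2\pi}\,\widehat g(2^jx)1_{[-\pi,\pi)}(x)$, and let $\widehat u_j(x)=\frac{\widehat g_{j+1}(x)}{\widehat g_j(2x)}\widehat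 u(x)$ and $\widehat v_j(x)=\widehat g_{j+1}(x)\widehat v(x)$. A filter $\widehat h$ has time domain coefficients $h_k=\frac1{2\pi}\int_{-\pi}^{\pi}\widehat h(x)e^{ikx}dx$. Let $(V_{j,k})_{k\in\mathbb Z}$, $j\ge0$, be the real sequences generated by $$V_{0,k}=\sum_{n\in\mathbb Z}g_{0,n}\,\xi_{k-n},\qquad V_{j+1,k}=\sum_{n\in\mathbb Z}\bigl(u_{j,k-2n}V_{j,n}+v_{j,k-2n}\,\varepsilon_{j,n}\bigr),$$ the series being limits in mean square of the symmetric partial sums. Then there is $\nu\in(0,1)$, depending only on $\widehat g$, such that the following holds. The process $V$ has a version with a.s. continuous paths on $[0,\infty)$; and if $X(t)=\int_0^tV(s)\,ds$ is the position process, computed from any such version, then for every $T\in\mathbb N$ there is a (finite) random variable $A'$, not depending on $J$, such that a.s., for all integers $J\ge0$, $$\sup_{t\in[0,T]}\Bigl|X(t)-\sum_{k=0}^{\lfloor(2^J-1)t\rfloor}2^{J/2}V_{J,k}\,\frac1{2^J}\Bigr|\le A'\,2^{-J\nu}.$$ -/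

import Mathlib

open MeasureTheory ProbabilityTheory Filter Topology

noncomputable section

namespace AnomalousDiffusion

/-! ### Continuous time spectral filters -/

/-- The spectral filter of the fractional Ornstein-Uhlenbeck process
`dV = -ζ V dt + σ dB_H`, with `d = H - 1/2`. -/
def fouFilter (σ ζ d x : ℝ) : ℝ :=
  σ * √(Real.Gamma (2 * d + 2) * Real.sin (Real.pi * (d + 1 / 2)))
    * (1 / √(ζ ^ 2 + x ^ 2)) * |x| ^ (-d)

/-- The spectral filter of the velocity of the fractional generalized Langevin equation with mass
`m`, friction constant `ζ`, Boltzmann constant `kB`, temperature `τ`, and `d = H - 1/2`. -/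
def fgleFilter (m ζ kB τ d x : ℝ) : ℝ :=
  let a := ζ * Real.Gamma (2 * d + 2) * Real.sin (Real.pi * (d + 1 / 2))
  let b := ζ * Real.Gamma (2 * d + 2) * Real.cos (Real.pi * (d + 1 / 2))
  let γ₀ := a ^ 2 + b ^ 2
  let γ₁ := 2 * b * m
  let γ₂ := m ^ 2
  let β := 1 + 2 * d
  let c := √(2 * ζ * kB * τ * Real.Gamma (2 * d + 2) * Real.sin (Real.pi * (d + 1 / 2)))
  c * (1 / √(γ₀ + γ₁ * |x| ^ β + γ₂ * |x| ^ (2 * β))) * |x| ^ d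

/-- `ghat` is the spectral filter of an fOU process or of an fGLE velocity process. -/
def IsVelocityFilter (ghat : ℝ → ℝ) : Prop :=
  (∃ σ ζ d : ℝ, 0 < σ ∧ 0 < ζ ∧ -(1 / 2) < d ∧ d < 1 / 2 ∧ ghat = fouFilter σ ζ d) ∨
  (∃ m ζ kB τ d : ℝ, 0 < m ∧ 0 < ζ ∧ 0 < kB ∧ 0 < τ ∧ 0 < d ∧ d < 1 / 2 ∧
    ghat = fgleFilter m ζ kB τ d)

/-! ### Brownian measure and stochastic integrals in the Fourier domain -/

/-- Borel subsets of `ℝ` of finite Lebesgue measure. -/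
abbrev FiniteBorel : Type := {A : Set ℝ // MeasurableSet A ∧ volume A < ⊤}

/-- `B` is a complex Gaussian random measure on `ℝ` with the Hermitian symmetry
`B(-A) = conj (B(A))` and control measure `E|B(dx)|² = dx`.
The values of `B` on sets that are not Borel of finite measure are irrelevant. -/
structure IsBrownianMeasure {Ω : Type*} [MeasurableSpace Ω] (P : Measure Ω)
    (B : Set ℝ → Ω → ℂ) : Prop where
  gaussian : IsGaussianProcess (fun A : FiniteBorel => B A.1) P
  centered : ∀ A : FiniteBorel, ∫ ω, B A.1 ω ∂P = 0
  covariance : ∀ A C : FiniteBorel,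
    ∫ ω, B A.1 ω * (starRingEnd ℂ) (B C.1 ω) ∂P = ((volume.real (A.1 ∩ C.1) : ℝ) : ℂ)
  additive : ∀ A C : FiniteBorel, Disjoint A.1 C.1 →
    ∀ᵐ ω ∂P, B (A.1 ∪ C.1) ω = B A.1 ω + B C.1 ω
  hermitian : ∀ A : FiniteBorel,
    ∀ᵐ ω ∂P, B (Neg.neg ⁻¹' A.1) ω = (starRingEnd ℂ) (B A.1 ω)

/-- `∫ s(x) B(dx)` for a simple function `s`. -/
def simpleIntegral {Ω : Type*} (B : Set ℝ → Ω → ℂ) (s : SimpleFunc ℝ ℂ) (ω : Ω) : ℂ :=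
  ∑ y ∈ s.range, y * B (s ⁻¹' {y}) ω

/-- `Y = ∫ f(x) B(dx)`: `Y` is the `L²(P)`-limit of the integrals of square integrable simple
functions that converge to `f` in `L²(ℝ)`. -/
def IsStochIntegral {Ω : Type*} [MeasurableSpace Ω] (P : Measure Ω) (B : Set ℝ → Ω → ℂ)
    (f : ℝ → ℂ) (Y : Ω → ℂ) : Prop :=
  MemLp f 2 volume ∧ MemLp Y 2 P ∧
    ∃ s : ℕ → SimpleFunc ℝ ℂ, (∀ n, MemLp (s n) 2 volume) ∧
      Tendsto (fun n => eLpNorm (fun x => s n x - f x) 2 volume) atTop (𝓝 0) ∧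
      Tendsto (fun n => eLpNorm (fun ω => simpleIntegral B (s n) ω - Y ω) 2 P) atTop (𝓝 0)

/-- `V(t) = ∫ e^{itx} ghat(x) B(dx)` for all `t ≥ 0`. -/
def IsVelocityProcess {Ω : Type*} [MeasurableSpace Ω] (P : Measure Ω) (B : Set ℝ → Ω → ℂ)
    (ghat : ℝ → ℝ) (V : ℝ → Ω → ℝ) : Prop :=
  ∀ t : ℝ, 0 ≤ t →
    IsStochIntegral P B (fun x => Complex.exp (Complex.I * t * x) * ghat x)
      (fun ω => (V t ω : ℂ))

/-- `W` is a version of `{V(t)}_{t ≥ 0}` with a.s. continuous paths. -/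
def IsContinuousVersion {Ω : Type*} [MeasurableSpace Ω] (P : Measure Ω)
    (V W : ℝ → Ω → ℝ) : Prop :=
  (∀ t : ℝ, 0 ≤ t → W t =ᵐ[P] V t) ∧
    ∀ᵐ ω ∂P, ContinuousOn (fun t => W t ω) (Set.Ici 0)

/-! ### Meyer multiresolution analysis, in the Fourier domain -/

/-- `uhat` is the transfer function of a (twice continuously differentiable) Meyer low-pass
conjugate mirror filter. -/
structure IsMeyerFilter (uhat : ℝ → ℝ) : Prop where
  smooth : ContDiff ℝ 2 uhat
  periodic : Function.Periodic uhat (2 * Real.pi)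
  even : ∀ x, uhat (-x) = uhat x
  pass_band : ∀ x, |x| ≤ Real.pi / 3 → uhat x = √2
  null_band : ∀ x, 2 * Real.pi / 3 ≤ |x| → |x| ≤ Real.pi → uhat x = 0
  mirror : ∀ x, uhat x ^ 2 + uhat (x + Real.pi) ^ 2 = 2

/-- The high-pass conjugate mirror filter `v̂(x) = e^{-ix} û(x + π)`. -/
def highPass (uhat : ℝ → ℝ) (x : ℝ) : ℂ :=
  Complex.exp (-Complex.I * x) * uhat (x + Real.pi)

/-- Fourier transform of the Meyer scaling function, `φ̂(x) = 2^{-1/2} û(x/2)`, `|x| ≤ 4π/3`. -/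
def scalingHat (uhat : ℝ → ℝ) (x : ℝ) : ℝ :=
  if |x| ≤ 4 * Real.pi / 3 then uhat (x / 2) / √2 else 0

/-- Fourier transform of the Meyer wavelet, `ψ̂(x) = 2^{-1/2} v̂(x/2) φ̂(x/2)`. -/
def waveletHat (uhat : ℝ → ℝ) (x : ℝ) : ℂ :=
  highPass uhat (x / 2) * scalingHat uhat (x / 2) / √2

/-! ### Discretization filters and discretization sequences -/

/-- The truncated discretization filter at scale `2^{-j}`: `ghat(2^j x)` for `x ∈ [-π, π)`,
extended `2π`-periodically. The factor `√(2π)` is the normalization under which filters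
`h_k = (2π)⁻¹ ∫ ĥ(x) e^{ikx} dx` applied to noise sequences of variance one match the convention
`V(t) = ∫ e^{itx} ghat(x) B(dx)`, `E|B(dx)|² = dx`, of continuous time. -/
def truncatedFilter (ghat : ℝ → ℝ) (j : ℕ) (x : ℝ) : ℝ :=
  √(2 * Real.pi) * ghat (2 ^ j * toIcoMod Real.two_pi_pos (-Real.pi) x)

/-- `û_j(x) = ĝ_{j+1}(x) / ĝ_j(2x) · û(x)`. -/
def lowFilter (ghat uhat : ℝ → ℝ) (j : ℕ) (x : ℝ) : ℂ :=
  ((truncatedFilter ghat (j + 1) x / truncatedFilter ghat j (2 * x) * uhat x : ℝ) : ℂ)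

/-- `v̂_j(x) = ĝ_{j+1}(x) v̂(x)`. -/
def highFilter (ghat uhat : ℝ → ℝ) (j : ℕ) (x : ℝ) : ℂ :=
  truncatedFilter ghat (j + 1) x * highPass uhat x

/-- The time domain filter `h_k = (2π)⁻¹ ∫_{-π}^{π} ĥ(x) e^{ikx} dx`. -/
def timeFilter (h : ℝ → ℂ) (k : ℤ) : ℂ :=
  (1 / (2 * Real.pi) : ℂ) *
    ∫ x in (-Real.pi)..Real.pi, h x * Complex.exp (Complex.I * k * x)

/-- `Y = ∑_{m = -∞}^{∞} a_m`, with convergence in `L²(P)` of the symmetric partial sums. -/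
def HasL2Sum {Ω : Type*} [MeasurableSpace Ω] (P : Measure Ω) (a : ℤ → Ω → ℂ)
    (Y : Ω → ℂ) : Prop :=
  MemLp Y 2 P ∧
    Tendsto (fun M : ℕ => eLpNorm
      (fun ω => (∑ m ∈ Finset.Icc (-(M : ℤ)) M, a m ω) - Y ω) 2 P) atTop (𝓝 0)

/-- `Vd j = (V_{j,k})_{k ∈ ℤ}` are the sequences generated by the wavelet recursion
`V_{j+1} = u_j * ↑₂V_j + v_j * ↑₂ε_j` from `V_0 = g_0 * ξ`, for the truncated filters of `ghat`.
The standard Gaussian noise sequences `ξ_k` and `ε_{j,k}` are the coefficients of the white noise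
that drives the velocity process with respect to the orthonormal Meyer basis
`φ(t - k)`, `2^{j/2} ψ(2^j t - k)`, `j ≥ 0`. -/
structure IsDiscretization {Ω : Type*} [MeasurableSpace Ω] (P : Measure Ω)
    (B : Set ℝ → Ω → ℂ) (ghat uhat : ℝ → ℝ)
    (ξ : ℤ → Ω → ℝ) (ε : ℕ → ℤ → Ω → ℝ) (Vd : ℕ → ℤ → Ω → ℝ) : Prop where
  scaling_noise : ∀ k : ℤ, IsStochIntegral P B
    (fun x => ((1 / √(2 * Real.pi) : ℝ) : ℂ) * Complex.exp (Complex.I * k * x)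
      * scalingHat uhat x)
    (fun ω => (ξ k ω : ℂ))
  wavelet_noise : ∀ (j : ℕ) (k : ℤ), IsStochIntegral P B
    (fun x => ((1 / √(2 * Real.pi) * (2 : ℝ) ^ (-(j : ℝ) / 2) : ℝ) : ℂ)
      * Complex.exp (Complex.I * k * ((x / 2 ^ j : ℝ) : ℂ))
      * (starRingEnd ℂ) (waveletHat uhat (x / 2 ^ j)))
    (fun ω => (ε j k ω : ℂ))
  initial : ∀ k : ℤ, HasL2Sum P
    (fun n ω => timeFilter (fun x => (truncatedFilter ghat 0 x : ℂ)) n * (ξ (k - n) ω : ℂ))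
    (fun ω => (Vd 0 k ω : ℂ))
  step : ∀ (j : ℕ) (k : ℤ), HasL2Sum P
    (fun n ω => timeFilter (lowFilter ghat uhat j) (k - 2 * n) * (Vd j n ω : ℂ)
      + timeFilter (highFilter ghat uhat j) (k - 2 * n) * (ε j n ω : ℂ))
    (fun ω => (Vd (j + 1) k ω : ℂ))

/-- The position process `X(t) = ∫_0^t V(s) ds`. -/
def position {Ω : Type*} (V : ℝ → Ω → ℝ) (t : ℝ) (ω : Ω) : ℝ :=
  ∫ s in (0 : ℝ)..t, V s ω

/-- The Riemann sum `∑_{k=0}^{⌊(2^J-1)t⌋} 2^{J/2} V_{J,k} 2^{-J}`. -/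
def riemannSum {Ω : Type*} (Vd : ℕ → ℤ → Ω → ℝ) (J : ℕ) (t : ℝ) (ω : Ω) : ℝ :=
  ∑ k ∈ Finset.range (⌊((2 : ℝ) ^ J - 1) * t⌋₊ + 1),
    (2 : ℝ) ^ ((J : ℝ) / 2) * Vd J (k : ℤ) ω * (1 / 2 ^ J)

end AnomalousDiffusion

end

/-! The wavelet recursion collapses in the Fourier domain. By induction on the scale, the conjugate
mirror identity (`downsample_reconstruction`) shows that `2^{J/2} V_{J,k}` is the stochastic
integral of `e^{ik2^{-J}x} φ̂(2^{-J}x) ĝ(2^J r(2^{-J}x))`, where `r` is reduction modulo `2π` to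
`[-π, π)`; this is `IsDiscretization.pairMem`. For `|2^{-J}x| ≤ 2π/3` one has `φ̂ = 1` and `r` is
the identity, so the integrand is exactly that of `V(k2^{-J})`. Beyond that band both integrands are
`O(|x|^{-1-d})`. Since the stochastic integral is an isometry, the mean square difference is
`O(2^{-Jh})` for every `0 ≤ h < d + 1/2` (`exists_eLpNorm_discretization_le`).

The same decay makes `|x|^h ĝ(x)` square integrable, so `V` is `h`-Hölder in mean square for `h ≤ 1`
(`exists_eLpNorm_increment_le`). Gaussianity upgrades this to every finite moment, and Kolmogorov's
criterion gives the continuous version.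

For the pathwise bound, `X(t)` minus the Riemann sum is dominated, for all `t ∈ [0,T]` at once, by
the integral over `[0,T+1]` of the distance between the path and the step function with values
`2^{J/2} V_{J,k}`, plus an endpoint term `O(2^{-J})` times the maximum of the path. The first
quantity has mean `O(2^{-Jh})`; weighting by `2^{Jν}` with `ν < h` and summing over `J` gives a
random variable of finite mean, hence a single almost surely finite constant
(`exists_measurable_bound_of_lintegral_le`). No maximal inequality in `t` is needed.

The stochastic integral is handled through its graph, the closed span of the pairs `(1_A, B(A))`.
Isometry, linearity and stability under limits are then statements about a closed subspace. -/

noncomputable section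

namespace AnomalousDiffusion

/-! ### The closed graph of the stochastic integral -/

section Graph

variable {Ω : Type*} [MeasurableSpace Ω] {P : Measure Ω} {B : Set ℝ → Ω → ℂ}

/-- The pair of classes of `f` and `Y` belongs to the subspace `S` of `L²(ℝ) × L²(P)`. -/
def PairMem (S : Submodule ℂ (Lp ℂ 2 (volume : Measure ℝ) × Lp ℂ 2 P))
    (f : ℝ → ℂ) (Y : Ω → ℂ) : Prop :=
  ∃ (hf : MemLp f 2 volume) (hY : MemLp Y 2 P), (hf.toLp f, hY.toLp Y) ∈ S

namespace PairMem

variable {S : Submodule ℂ (Lp ℂ 2 (volume : Measure ℝ) × Lp ℂ 2 P)} {f g : ℝ → ℂ} {Y Z : Ω → ℂ}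

lemma add (hf : PairMem S f Y) (hg : PairMem S g Z) :
    PairMem S (fun x => f x + g x) (fun ω => Y ω + Z ω) := by
  obtain ⟨hf, hY, h⟩ := hf
  obtain ⟨hg, hZ, h'⟩ := hg
  exact ⟨hf.add hg, hY.add hZ, S.add_mem h h'⟩

lemma const_mul (c : ℂ) (hf : PairMem S f Y) :
    PairMem S (fun x => c * f x) (fun ω => c * Y ω) := by
  obtain ⟨hf, hY, h⟩ := hf
  exact ⟨hf.const_mul c, hY.const_mul c, S.smul_mem c h⟩

lemma sub (hf : PairMem S f Y) (hg : PairMem S g Z) :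
    PairMem S (fun x => f x - g x) (fun ω => Y ω - Z ω) := by
  obtain ⟨hf, hY, h⟩ := hf
  obtain ⟨hg, hZ, h'⟩ := hg
  exact ⟨hf.sub hg, hY.sub hZ, S.sub_mem h h'⟩

lemma zero : PairMem S (fun _ => 0) (fun _ => 0) :=
  ⟨MemLp.zero', MemLp.zero', S.zero_mem⟩

lemma sum {ι : Type*} (s : Finset ι) {f : ι → ℝ → ℂ} {Y : ι → Ω → ℂ}
    (h : ∀ i ∈ s, PairMem S (f i) (Y i)) :
    PairMem S (fun x => ∑ i ∈ s, f i x) (fun ω => ∑ i ∈ s, Y i ω) := by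
  classical
  induction s using Finset.induction_on with
  | empty => simpa using zero
  | insert i s hi ih =>
    simp only [Finset.sum_insert hi]
    exact (h i (Finset.mem_insert_self i s)).add
      (ih fun j hj => h j (Finset.mem_insert_of_mem hj))

lemma congr (hf : PairMem S f Y) (hfg : f =ᵐ[volume] g) (hYZ : Y =ᵐ[P] Z) : PairMem S g Z := by
  obtain ⟨hf, hY, h⟩ := hf
  refine ⟨(memLp_congr_ae hfg).1 hf, (memLp_congr_ae hYZ).1 hY, ?_⟩
  rwa [← MemLp.toLp_congr hf _ hfg, ← MemLp.toLp_congr hY _ hYZ]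

end PairMem

lemma IsBrownianMeasure.memLp (hB : IsBrownianMeasure P B) (A : FiniteBorel) :
    MemLp (B A.1) 2 P :=
  (hB.gaussian.hasGaussianLaw_eval A).memLp_two

/-- The span of the pairs `(1_A, B(A))`. -/
def simpleGraph (hB : IsBrownianMeasure P B) :
    Submodule ℂ (Lp ℂ 2 (volume : Measure ℝ) × Lp ℂ 2 P) :=
  Submodule.span ℂ (Set.range fun A : FiniteBorel =>
    (indicatorConstLp 2 A.2.1 A.2.2.ne (1 : ℂ), (hB.memLp A).toLp (B A.1)))

/-- The graph of the stochastic integral with respect to `B`. -/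
def stochGraph (hB : IsBrownianMeasure P B) :
    Submodule ℂ (Lp ℂ 2 (volume : Measure ℝ) × Lp ℂ 2 P) :=
  (simpleGraph hB).topologicalClosure

/-- On generators this is the covariance identity of `B`; sesquilinearity carries it to the span. -/
lemma simpleGraph_inner (hB : IsBrownianMeasure P B)
    {z w : Lp ℂ 2 (volume : Measure ℝ) × Lp ℂ 2 P}
    (hz : z ∈ simpleGraph hB) (hw : w ∈ simpleGraph hB) :
    inner ℂ z.2 w.2 = inner ℂ z.1 w.1 := by
  induction hz, hw using Submodule.span_induction₂ with
  | mem_mem x y hx hy =>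
    obtain ⟨A, rfl⟩ := hx
    obtain ⟨C, rfl⟩ := hy
    dsimp only
    rw [L2.inner_indicatorConstLp_one_indicatorConstLp_one A.2.1 C.2.1 A.2.2.ne C.2.2.ne,
      L2.inner_def]
    -- The sets are swapped because the inner product is conjugate linear in its first slot.
    have h := hB.covariance C A
    rw [Set.inter_comm] at h
    trans ∫ ω, B C.1 ω * (starRingEnd ℂ) (B A.1 ω) ∂P
    · refine integral_congr_ae ?_
      filter_upwards [(hB.memLp A).coeFn_toLp, (hB.memLp C).coeFn_toLp] with ω h1 h2
      rw [h1, h2]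
      rfl
    · exact h
  | zero_left y hy => simp
  | zero_right y hy => simp
  | add_left x y z hx hy hz h h' => simp [inner_add_left, h, h']
  | add_right x y z hx hy hz h h' => simp [inner_add_right, h, h']
  | smul_left r x y hx hy h => simp [inner_smul_left, h]
  | smul_right r x y hx hy h => simp [inner_smul_right, h]

/-- Equality of the two norms is a closed condition, so it passes from the span to its closure. -/
lemma stochGraph_norm (hB : IsBrownianMeasure P B)
    {z : Lp ℂ 2 (volume : Measure ℝ) × Lp ℂ 2 P} (hz : z ∈ stochGraph hB) : ‖z.2‖ = ‖z.1‖ := by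
  have hclosed : IsClosed {z : Lp ℂ 2 (volume : Measure ℝ) × Lp ℂ 2 P | ‖z.2‖ = ‖z.1‖} :=
    isClosed_eq (by fun_prop) (by fun_prop)
  refine closure_minimal (fun w hw => ?_) hclosed hz
  have h := simpleGraph_inner hB hw hw
  rw [inner_self_eq_norm_sq_to_K, inner_self_eq_norm_sq_to_K] at h
  have h' : ‖w.2‖ ^ 2 = ‖w.1‖ ^ 2 := by exact_mod_cast h
  exact (sq_eq_sq₀ (norm_nonneg _) (norm_nonneg _)).1 h'

lemma PairMem.eLpNorm_eq {hB : IsBrownianMeasure P B} {f : ℝ → ℂ} {Y : Ω → ℂ}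
    (h : PairMem (stochGraph hB) f Y) : eLpNorm Y 2 P = eLpNorm f 2 volume := by
  obtain ⟨hf, hY, h⟩ := h
  have h := stochGraph_norm hB h
  dsimp only at h
  rw [Lp.norm_toLp, Lp.norm_toLp] at h
  exact (ENNReal.toReal_eq_toReal_iff' hY.2.ne hf.2.ne).1 h

lemma pairMem_indicator (hB : IsBrownianMeasure P B) (A : FiniteBorel) :
    PairMem (simpleGraph hB) (A.1.indicator fun _ => 1) (B A.1) :=
  ⟨memLp_indicator_const 2 A.2.1 1 (Or.inr A.2.2.ne), hB.memLp A,
    Submodule.subset_span ⟨A, rfl⟩⟩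

lemma pairMem_simpleFunc (hB : IsBrownianMeasure P B) {s : SimpleFunc ℝ ℂ}
    (hs : MemLp s 2 volume) : PairMem (simpleGraph hB) s (simpleIntegral B s) := by
  have h : PairMem (simpleGraph hB)
      (fun x => ∑ y ∈ s.range, y * (s ⁻¹' {y}).indicator (fun _ => (1 : ℂ)) x)
      (fun ω => ∑ y ∈ s.range, y * B (s ⁻¹' {y}) ω) := by
    refine PairMem.sum _ fun y _ => ?_
    -- The level set of the value `0` may have infinite measure, but its coefficient vanishes.
    by_cases hy : y = 0
    · simpa [hy] using PairMem.zero
    · exact (pairMem_indicator hB ⟨s ⁻¹' {y}, s.measurableSet_preimage _,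
        SimpleFunc.measure_preimage_lt_top_of_memLp (by simp) (by simp) s hs y hy⟩).const_mul y
  refine h.congr (ae_of_all _ fun x => ?_) (ae_of_all _ fun ω => rfl)
  dsimp only
  rw [Finset.sum_eq_single_of_mem (s x) (s.mem_range_self x)]
  · simp
  · intro y _ hy
    simp [Set.indicator, hy.symm]

lemma tendsto_toLp_of_eLpNorm {α : Type*} [MeasurableSpace α] {μ : Measure α}
    {F : ℕ → α → ℂ} {f : α → ℂ} (hF : ∀ n, MemLp (F n) 2 μ) (hf : MemLp f 2 μ)
    (h : Tendsto (fun n => eLpNorm (fun x => F n x - f x) 2 μ) atTop (𝓝 0)) :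
    Tendsto (fun n => (hF n).toLp (F n)) atTop (𝓝 (hf.toLp f)) :=
  (Lp.tendsto_Lp_iff_tendsto_eLpNorm'' F hF f hf).2 h

lemma IsStochIntegral.pairMem (hB : IsBrownianMeasure P B) {f : ℝ → ℂ} {Y : Ω → ℂ}
    (h : IsStochIntegral P B f Y) : PairMem (stochGraph hB) f Y := by
  obtain ⟨hf, hY, s, hs, hsf, hsY⟩ := h
  refine ⟨hf, hY, ?_⟩
  have hmem := fun n => pairMem_simpleFunc hB (hs n)
  choose h1 h2 h3 using hmem
  refine mem_closure_of_tendsto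
    ((tendsto_toLp_of_eLpNorm h1 hf hsf).prodMk_nhds (tendsto_toLp_of_eLpNorm h2 hY hsY))
    (Eventually.of_forall h3)

/-- If stochastic integrals converge in mean square, then so do the integrands, and the limit is
the integral of the limit. -/
lemma PairMem.exists_limit {hB : IsBrownianMeasure P B} {F : ℕ → ℝ → ℂ} {Z : ℕ → Ω → ℂ}
    {Y : Ω → ℂ} (hF : ∀ n, PairMem (stochGraph hB) (F n) (Z n)) (hY : MemLp Y 2 P)
    (hlim : Tendsto (fun n => eLpNorm (fun ω => Z n ω - Y ω) 2 P) atTop (𝓝 0)) :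
    ∃ f, PairMem (stochGraph hB) f Y ∧
      Tendsto (fun n => eLpNorm (fun x => F n x - f x) 2 volume) atTop (𝓝 0) := by
  choose h1 h2 h3 using hF
  have hZ := tendsto_toLp_of_eLpNorm h2 hY hlim
  have hc : CauchySeq fun n => (h1 n).toLp (F n) := by
    refine Metric.cauchySeq_iff'.2 fun ε hε => ?_
    obtain ⟨N, hN⟩ := Metric.cauchySeq_iff'.1 hZ.cauchySeq ε hε
    refine ⟨N, fun n hn => ?_⟩
    -- The isometry, applied to differences, transfers the Cauchy property from the integrals to the
    -- integrands.
    have h := stochGraph_norm hB ((stochGraph hB).sub_mem (h3 n) (h3 N))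
    have := hN n hn
    rw [dist_eq_norm] at this ⊢
    exact h ▸ this
  obtain ⟨f, hf⟩ := cauchySeq_tendsto_of_complete hc
  have hmem : (f, hY.toLp Y) ∈ stochGraph hB :=
    (simpleGraph hB).isClosed_topologicalClosure.mem_of_tendsto (hf.prodMk_nhds hZ)
      (Eventually.of_forall h3)
  refine ⟨f, ⟨Lp.memLp f, hY, by rwa [Lp.toLp_coeFn]⟩, ?_⟩
  refine (Lp.tendsto_Lp_iff_tendsto_eLpNorm'' F h1 f (Lp.memLp f)).1 ?_
  rwa [Lp.toLp_coeFn]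

end Graph

/-! ### Moments of stochastic integrals -/

section Moments

variable {Ω : Type*} [MeasurableSpace Ω] {P : Measure Ω} {B : Set ℝ → Ω → ℂ}

lemma eLpNorm_id_gaussianReal (v : NNReal) (p : ENNReal) :
    eLpNorm id p (gaussianReal 0 v) =
      ENNReal.ofReal √v * eLpNorm id p (gaussianReal 0 1) := by
  have h : (gaussianReal 0 1).map (√(v : ℝ) * ·) = gaussianReal 0 v := by
    rw [gaussianReal_map_const_mul]
    congr 1
    · simp
    · ext
      simp
  rw [← h, eLpNorm_map_measure (by fun_prop) (by fun_prop)]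
  have : (id ∘ fun x : ℝ => √(v : ℝ) * x) = √(v : ℝ) • (id : ℝ → ℝ) := by
    ext x
    simp
  rw [this, eLpNorm_const_smul, Real.enorm_eq_ofReal (Real.sqrt_nonneg _)]

lemma eLpNorm_two_gaussianReal_ne_zero : eLpNorm id 2 (gaussianReal 0 1) ≠ 0 := by
  intro h
  rw [eLpNorm_eq_zero_iff (by fun_prop) (by simp)] at h
  have h1 : Var[id; gaussianReal 0 1] = 1 := by simp [variance_id_gaussianReal]
  rw [variance_congr h, variance_zero] at h1
  exact zero_ne_one h1

/-- All moments of a centered Gaussian variable are controlled by its variance. -/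
lemma eLpNorm_le_of_hasGaussianLaw {p : ENNReal} (hp : p ≠ ⊤) {X : Ω → ℝ}
    (hX : HasGaussianLaw X P) (h0 : ∫ ω, X ω ∂P = 0) :
    eLpNorm X p P ≤ eLpNorm id p (gaussianReal 0 1) / eLpNorm id 2 (gaussianReal 0 1) *
      eLpNorm X 2 P := by
  have hfin := (memLp_id_gaussianReal' (μ := 0) (v := 1) p hp).2.ne
  have hfin2 := (memLp_id_gaussianReal' (μ := 0) (v := 1) 2 (by simp)).2.ne
  have key (q : ENNReal) : eLpNorm X q P =
      ENNReal.ofReal √(Var[X; P].toNNReal) * eLpNorm id q (gaussianReal 0 1) := by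
    rw [← eLpNorm_id_gaussianReal, ← h0, ← hX.map_eq_gaussianReal,
      eLpNorm_map_measure (by fun_prop) hX.aemeasurable]
    rfl
  rw [key p, key 2, mul_left_comm,
    ENNReal.div_mul_cancel eLpNorm_two_gaussianReal_ne_zero hfin2]

/-- Real and imaginary parts are centered real Gaussians, each contributing one copy of the real
constant. -/
lemma exists_eLpNorm_le_of_hasGaussianLaw_complex (P : Measure Ω) {p : ENNReal} (hp1 : 1 ≤ p)
    (hp : p ≠ ⊤) :
    ∃ C : ENNReal, C ≠ ⊤ ∧ ∀ Z : Ω → ℂ, HasGaussianLaw Z P → ∫ ω, Z ω ∂P = 0 →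
      eLpNorm Z p P ≤ C * eLpNorm Z 2 P := by
  have hfin := (memLp_id_gaussianReal' (μ := 0) (v := 1) p hp).2.ne
  have hC := ENNReal.div_ne_top hfin eLpNorm_two_gaussianReal_ne_zero
  set C := eLpNorm id p (gaussianReal 0 1) / eLpNorm id 2 (gaussianReal 0 1)
  refine ⟨C + C, ENNReal.add_ne_top.2 ⟨hC, hC⟩, fun Z hg h0 => ?_⟩
  have hint := hg.integrable
  have hre : eLpNorm (fun ω => (Z ω).re) p P ≤ C * eLpNorm Z 2 P := by
    refine (eLpNorm_le_of_hasGaussianLaw hp (hg.map_fun Complex.reCLM) ?_).trans ?_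
    · have := integral_re hint
      simp only [h0] at this
      simpa using this
    · gcongr
      exact eLpNorm_mono fun ω => by simpa using Complex.abs_re_le_norm (Z ω)
  have him : eLpNorm (fun ω => (Z ω).im) p P ≤ C * eLpNorm Z 2 P := by
    refine (eLpNorm_le_of_hasGaussianLaw hp (hg.map_fun Complex.imCLM) ?_).trans ?_
    · have := integral_im hint
      simp only [h0] at this
      simpa using this
    · gcongr
      exact eLpNorm_mono fun ω => by simpa using Complex.abs_im_le_norm (Z ω)
  have hsm := hint.1
  calc eLpNorm Z p P
      ≤ eLpNorm ((fun ω => ‖(Z ω).re‖) + fun ω => ‖(Z ω).im‖) p P :=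
        eLpNorm_mono_real fun ω => Complex.norm_le_abs_re_add_abs_im _
    _ ≤ eLpNorm (fun ω => ‖(Z ω).re‖) p P + eLpNorm (fun ω => ‖(Z ω).im‖) p P :=
        eLpNorm_add_le (Complex.continuous_re.comp_aestronglyMeasurable hsm).norm
          (Complex.continuous_im.comp_aestronglyMeasurable hsm).norm hp1
    _ ≤ C * eLpNorm Z 2 P + C * eLpNorm Z 2 P := by
        rw [eLpNorm_norm, eLpNorm_norm]
        exact add_le_add hre him
    _ = (C + C) * eLpNorm Z 2 P := by ring

lemma coeFn_sum_smul {α ι : Type*} [MeasurableSpace α] {μ : Measure α} (s : Finset ι) (c : ι → ℂ)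
    {F : ι → Lp ℂ 2 μ} {f : ι → α → ℂ} (hF : ∀ i, F i =ᵐ[μ] f i) :
    ⇑(∑ i ∈ s, c i • F i) =ᵐ[μ] fun x => ∑ i ∈ s, c i * f i x := by
  classical
  induction s using Finset.induction_on with
  | empty =>
    simp only [Finset.sum_empty]
    exact Lp.coeFn_zero ℂ 2 μ
  | insert i s hi ih =>
    rw [Finset.sum_insert hi]
    filter_upwards [ih, Lp.coeFn_add (c i • F i) (∑ i ∈ s, c i • F i), Lp.coeFn_smul (c i) (F i),
      hF i] with x h1 h2 h3 h4
    rw [h2, Pi.add_apply, h1, h3, Pi.smul_apply, h4, Finset.sum_insert hi, smul_eq_mul]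

/-- An element of the span is a finite combination of values of `B`, that is, a real linear image of
a centered Gaussian vector. -/
lemma simpleGraph_gaussian (hB : IsBrownianMeasure P B)
    {z : Lp ℂ 2 (volume : Measure ℝ) × Lp ℂ 2 P} (hz : z ∈ simpleGraph hB) :
    HasGaussianLaw (z.2 : Ω → ℂ) P ∧ ∫ ω, z.2 ω ∂P = 0 := by
  obtain ⟨c, rfl⟩ := Finsupp.mem_span_range_iff_exists_finsupp.1 hz
  have heq : ⇑(c.sum fun i a => a • ((indicatorConstLp 2 i.2.1 i.2.2.ne (1 : ℂ),
      (hB.memLp i).toLp (B i.1)) : Lp ℂ 2 (volume : Measure ℝ) × Lp ℂ 2 P)).2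
      =ᵐ[P] fun ω => ∑ i ∈ c.support, c i * B i.1 ω := by
    rw [Finsupp.sum, Prod.snd_sum]
    exact coeFn_sum_smul c.support c fun i => (hB.memLp i).coeFn_toLp
  constructor
  · have hL : HasGaussianLaw (fun ω => (∑ i : c.support,
        (c i.1 • ContinuousLinearMap.proj (R := ℝ) i : (c.support → ℂ) →L[ℝ] ℂ))
        (c.support.restrict (fun A : FiniteBorel => B A.1 ω))) P :=
      (hB.gaussian.hasGaussianLaw c.support).map_fun _
    refine hL.congr (EventuallyEq.trans (ae_of_all _ fun ω => ?_) heq.symm)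
    simp only [_root_.sum_apply, _root_.smul_apply,
      ContinuousLinearMap.proj_apply, Finset.restrict, smul_eq_mul]
    exact Finset.sum_coe_sort c.support (fun i => c i * B i.1 ω)
  · have := hB.gaussian.isProbabilityMeasure
    rw [integral_congr_ae heq, integral_finsetSum]
    · simp [integral_const_mul, hB.centered]
    · exact fun i _ => ((hB.memLp i).integrable one_le_two).const_mul _

/-- All moments of a stochastic integral are controlled by the `L²` norm of the integrand. -/
lemma exists_eLpNorm_le_eLpNorm_two (hB : IsBrownianMeasure P B) {p : ENNReal} (hp1 : 1 ≤ p)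
    (hp : p ≠ ⊤) :
    ∃ C : ENNReal, C ≠ ⊤ ∧ ∀ (f : ℝ → ℂ) (Y : Ω → ℂ), PairMem (stochGraph hB) f Y →
      eLpNorm Y p P ≤ C * eLpNorm f 2 volume := by
  obtain ⟨C, hCtop, hC⟩ := exists_eLpNorm_le_of_hasGaussianLaw_complex P hp1 hp
  refine ⟨C, hCtop, fun f Y hfY => ?_⟩
  rw [← hfY.eLpNorm_eq]
  obtain ⟨hf, hY, hmem⟩ := hfY
  obtain ⟨z, hz, hlim⟩ := mem_closure_iff_seq_limit.1 hmem
  have hlim2 : Tendsto (fun n => (z n).2) atTop (𝓝 (hY.toLp Y)) :=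
    (continuous_snd.tendsto _).comp hlim
  obtain ⟨ns, hns, hae⟩ := (tendstoInMeasure_of_tendsto_Lp hlim2).exists_seq_tendsto_ae
  have hbound : eLpNorm (hY.toLp Y) p P ≤ C * ‖hY.toLp Y‖ₑ := by
    -- Fatou along an almost surely convergent subsequence: the moment bound survives because the
    -- `L²` norms on its right-hand side converge.
    refine (Lp.eLpNorm_lim_le_liminf_eLpNorm
      (fun n => Lp.aestronglyMeasurable (z (ns n)).2) _ hae).trans ?_
    have hle : ∀ n, eLpNorm (z (ns n)).2 p P ≤ C * ‖(z (ns n)).2‖ₑ := fun n => by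
      obtain ⟨hg, h0⟩ := simpleGraph_gaussian hB (hz (ns n))
      rw [Lp.enorm_def]
      exact hC _ hg h0
    refine (liminf_le_liminf (Eventually.of_forall hle)).trans_eq ?_
    refine (ENNReal.Tendsto.const_mul ?_ (Or.inr hCtop)).liminf_eq
    exact (hlim2.comp hns.tendsto_atTop).enorm
  rwa [eLpNorm_congr_ae hY.coeFn_toLp, Lp.enorm_def, eLpNorm_congr_ae hY.coeFn_toLp] at hbound

end Moments

/-! ### Continuous modifications -/

section Kolmogorov

/-- Successive dyadic approximations of a point either coincide or are neighbours on the finer grid,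
so passing from one to the next costs at most one grid increment. -/
lemma floor_two_pow_succ (n : ℕ) (t : ℝ) :
    ⌊(2 : ℝ) ^ (n + 1) * t⌋₊ = 2 * ⌊(2 : ℝ) ^ n * t⌋₊ ∨
      ⌊(2 : ℝ) ^ (n + 1) * t⌋₊ = 2 * ⌊(2 : ℝ) ^ n * t⌋₊ + 1 := by
  have h : ⌊(2 : ℝ) ^ n * t⌋₊ = ⌊(2 : ℝ) ^ (n + 1) * t⌋₊ / 2 := by
    rw [← Nat.floor_div_ofNat]
    congr 1
    rw [pow_succ]
    ring
  omega

/-- The dyadic approximation `⌊2ⁿ t⌋ / 2ⁿ` of `t ≥ 0`. -/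
def dyadic (n : ℕ) (t : ℝ) : ℝ := (⌊(2 : ℝ) ^ n * t⌋₊ : ℝ) / 2 ^ n

lemma dyadic_nonneg (n : ℕ) (t : ℝ) : 0 ≤ dyadic n t := by
  unfold dyadic
  positivity

lemma abs_dyadic_sub_le (n : ℕ) {t : ℝ} (ht : 0 ≤ t) : |dyadic n t - t| ≤ (1 / 2) ^ n := by
  have h2 : (0 : ℝ) < 2 ^ n := by positivity
  have h1 := Nat.floor_le (mul_nonneg h2.le ht)
  have h3 := Nat.lt_floor_add_one ((2 : ℝ) ^ n * t)
  have : dyadic n t - t = ((⌊(2 : ℝ) ^ n * t⌋₊ : ℝ) - 2 ^ n * t) / 2 ^ n := by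
    unfold dyadic
    field_simp
  rw [this, abs_div, abs_of_pos h2, one_div, inv_pow, div_le_iff₀ h2, inv_mul_cancel₀ h2.ne',
    abs_le]
  constructor <;> linarith

/-- Chaining: the values along the dyadic approximations of a point form a Cauchy sequence with
geometric steps, and nearby points have equal or adjacent approximations at the level given by their
distance. -/
lemma exists_continuous_limit_of_dyadic_increments {v : ℝ → ℝ} {r : ℝ} (hr0 : 0 < r)
    (hr1 : r < 1)
    (hv : ∀ T : ℕ, ∃ C : ℝ, ∀ n k : ℕ, k < T * 2 ^ n →
      |v (((k + 1 : ℕ) : ℝ) / 2 ^ n) - v ((k : ℝ) / 2 ^ n)| ≤ C * r ^ n) :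
    ∃ w : ℝ → ℝ, Continuous w ∧
      ∀ t, Tendsto (fun n => v (dyadic n t)) atTop (𝓝 (w t)) := by
  have hidx (T : ℕ) (hT : 0 < T) (t : ℝ) (ht : t < T) (n : ℕ) :
      ⌊(2 : ℝ) ^ n * t⌋₊ < T * 2 ^ n := by
    refine (Nat.floor_lt' (by positivity)).2 ?_
    push_cast
    rw [mul_comm]
    exact mul_lt_mul_of_pos_right ht (by positivity)
  have hstep (T : ℕ) (hT : 0 < T) (C : ℝ)
      (hC : ∀ n k : ℕ, k < T * 2 ^ n →
        |v (((k + 1 : ℕ) : ℝ) / 2 ^ n) - v ((k : ℝ) / 2 ^ n)| ≤ C * r ^ n)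
      (t : ℝ) (ht : t < T) (n : ℕ) :
      dist (v (dyadic n t)) (v (dyadic (n + 1) t)) ≤ C * r ^ n := by
    have hCn : 0 ≤ C * r ^ n := (abs_nonneg _).trans (hC n 0 (by positivity))
    have hi := hidx T hT t ht (n + 1)
    have heq : dyadic n t = ((2 * ⌊(2 : ℝ) ^ n * t⌋₊ : ℕ) : ℝ) / 2 ^ (n + 1) := by
      unfold dyadic
      push_cast
      rw [pow_succ]
      field_simp
    rcases floor_two_pow_succ n t with h | h
    · have : dyadic n t = dyadic (n + 1) t := by rw [heq, ← h]; rfl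
      simpa [this] using hCn
    · have h2 : dyadic (n + 1) t
          = ((2 * ⌊(2 : ℝ) ^ n * t⌋₊ + 1 : ℕ) : ℝ) / 2 ^ (n + 1) := by
        rw [← h]; rfl
      rw [heq, h2, dist_comm, Real.dist_eq]
      refine (hC (n + 1) (2 * ⌊(2 : ℝ) ^ n * t⌋₊) (by omega)).trans ?_
      rw [pow_succ, ← mul_assoc]
      exact mul_le_of_le_one_right hCn hr1.le
  have hex (t : ℝ) : ∃ y, Tendsto (fun n => v (dyadic n t)) atTop (𝓝 y) := by
    obtain ⟨T, hT⟩ := exists_nat_gt (max t 0)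
    have hT0 : 0 < T := by exact_mod_cast (le_max_right t 0).trans_lt hT
    obtain ⟨C, hC⟩ := hv T
    exact cauchySeq_tendsto_of_complete (cauchySeq_of_le_geometric r C hr1
      (hstep T hT0 C hC t ((le_max_left t 0).trans_lt hT)))
  choose w hw using hex
  refine ⟨w, Metric.continuous_iff.2 fun t ε hε => ?_, hw⟩
  obtain ⟨T, hT⟩ := exists_nat_gt (max (t + 1) 0)
  have hT0 : 0 < T := by exact_mod_cast (le_max_right _ 0).trans_lt hT
  have htT : t + 1 < T := (le_max_left _ 0).trans_lt hT
  obtain ⟨C, hC⟩ := hv T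
  have hC0 : 0 ≤ C := by simpa using (abs_nonneg _).trans (hC 0 0 (by simpa using hT0))
  have hbd (s : ℝ) (hs : s < T) (n : ℕ) : dist (v (dyadic n s)) (w s) ≤ C * r ^ n / (1 - r) :=
    dist_le_of_le_geometric_of_tendsto r C hr1 (hstep T hT0 C hC s hs) (hw s) n
  obtain ⟨n, hn⟩ : ∃ n : ℕ, C * r ^ n / (1 - r) + C * r ^ n + C * r ^ n / (1 - r) < ε := by
    have h0 : Tendsto (fun n : ℕ => C * r ^ n) atTop (𝓝 (C * 0)) :=
      (tendsto_pow_atTop_nhds_zero_of_lt_one hr0.le hr1).const_mul C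
    have := ((h0.div_const (1 - r)).add h0).add (h0.div_const (1 - r))
    simp only [mul_zero, zero_div, add_zero] at this
    exact (this.eventually (gt_mem_nhds hε)).exists
  refine ⟨(1 / 2) ^ n, by positivity, fun s hs => ?_⟩
  rw [Real.dist_eq] at hs
  have hs1 : |s - t| < 1 := hs.trans_le (pow_le_one₀ (by norm_num) (by norm_num))
  have hsT : s < T := by
    have := (abs_lt.1 hs1).2
    linarith
  have hadj (a b : ℝ) (hab : a ≤ b) (hbT : b < T) (hba : b - a < (1 / 2) ^ n) :
      dist (v (dyadic n a)) (v (dyadic n b)) ≤ C * r ^ n := by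
    have h2 : (0 : ℝ) < 2 ^ n := by positivity
    have h1 : ⌊(2 : ℝ) ^ n * a⌋₊ ≤ ⌊(2 : ℝ) ^ n * b⌋₊ :=
      Nat.floor_le_floor (mul_le_mul_of_nonneg_left hab h2.le)
    have h3 : ⌊(2 : ℝ) ^ n * b⌋₊ ≤ ⌊(2 : ℝ) ^ n * a⌋₊ + 1 := by
      -- The natural number floor sends negative points to `0`, so these need their own argument.
      rcases le_or_gt 0 a with ha | ha
      · rw [← Nat.floor_add_one (by positivity)]
        refine Nat.floor_le_floor ?_
        have : (2 : ℝ) ^ n * (b - a) ≤ 1 := by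
          rw [one_div, inv_pow] at hba
          calc (2 : ℝ) ^ n * (b - a) ≤ 2 ^ n * (2 ^ n)⁻¹ :=
                mul_le_mul_of_nonneg_left hba.le h2.le
            _ = 1 := mul_inv_cancel₀ h2.ne'
        linarith
      · have : ⌊(2 : ℝ) ^ n * b⌋₊ ≤ ⌊(1 : ℝ)⌋₊ := by
          refine Nat.floor_le_floor ?_
          rw [one_div, inv_pow] at hba
          calc (2 : ℝ) ^ n * b ≤ 2 ^ n * (2 ^ n)⁻¹ :=
                mul_le_mul_of_nonneg_left (by linarith) h2.le
            _ = 1 := mul_inv_cancel₀ h2.ne'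
        simp only [Nat.floor_one] at this
        omega
    have hi := hidx T hT0 b hbT n
    rcases (show ⌊(2 : ℝ) ^ n * b⌋₊ = ⌊(2 : ℝ) ^ n * a⌋₊ ∨
      ⌊(2 : ℝ) ^ n * b⌋₊ = ⌊(2 : ℝ) ^ n * a⌋₊ + 1 by omega) with h | h
    · have : dyadic n b = dyadic n a := by unfold dyadic; rw [h]
      rw [this, dist_self]
      positivity
    · have : dyadic n b = ((⌊(2 : ℝ) ^ n * a⌋₊ + 1 : ℕ) : ℝ) / 2 ^ n := by
        rw [← h]; rfl
      rw [this, dist_comm]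
      exact hC n _ (by omega)
  have hmid : dist (v (dyadic n s)) (v (dyadic n t)) ≤ C * r ^ n := by
    rcases le_total s t with h | h
    · refine hadj s t h (by linarith) ?_
      rw [abs_sub_comm] at hs
      exact (le_abs_self _).trans_lt hs
    · rw [dist_comm]
      exact hadj t s h hsT ((le_abs_self _).trans_lt hs)
  calc dist (w s) (w t)
      ≤ dist (w s) (v (dyadic n s)) + dist (v (dyadic n s)) (v (dyadic n t))
        + dist (v (dyadic n t)) (w t) := dist_triangle4 _ _ _ _
    _ ≤ C * r ^ n / (1 - r) + C * r ^ n + C * r ^ n / (1 - r) := by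
        gcongr
        · rw [dist_comm]
          exact hbd s hsT n
        · exact hbd t (by linarith) n
    _ < ε := hn

variable {Ω : Type*} [MeasurableSpace Ω] {P : Measure Ω}

/-- The Kolmogorov continuity theorem for real processes on `[0, ∞)`. -/
theorem exists_continuous_modification {V : ℝ → Ω → ℝ} (hV : ∀ t, 0 ≤ t → AEMeasurable (V t) P)
    {p : ℝ} (hp : 0 < p) {K : ENNReal} (hK : K ≠ ⊤)
    (hinc : ∀ s t, 0 ≤ s → 0 ≤ t →
      ∫⁻ ω, ‖V t ω - V s ω‖ₑ ^ p ∂P ≤ K * ENNReal.ofReal (|t - s| ^ 2)) :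
    ∃ W : ℝ → Ω → ℝ, (∀ t, Measurable (W t)) ∧ (∀ ω, Continuous fun t => W t ω) ∧
      ∀ t, 0 ≤ t → W t =ᵐ[P] V t := by
  classical
  have hV' (t : ℝ) : ∃ U : Ω → ℝ, Measurable U ∧ (0 ≤ t → U =ᵐ[P] V t) := by
    by_cases ht : 0 ≤ t
    · exact ⟨(hV t ht).mk (V t), (hV t ht).measurable_mk, fun _ => (hV t ht).ae_eq_mk.symm⟩
    · exact ⟨fun _ => 0, measurable_const, fun h => absurd h ht⟩
  choose U hUm hUV using hV'
  have hincU (s t : ℝ) (hs : 0 ≤ s) (ht : 0 ≤ t) :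
      ∫⁻ ω, ‖U t ω - U s ω‖ₑ ^ p ∂P ≤ K * ENNReal.ofReal (|t - s| ^ 2) := by
    refine le_of_eq_of_le (lintegral_congr_ae ?_) (hinc s t hs ht)
    filter_upwards [hUV s hs, hUV t ht] with ω h1 h2
    rw [h1, h2]
  have hm (s t : ℝ) : Measurable fun ω => ‖U t ω - U s ω‖ₑ ^ p :=
    ((hUm t).sub (hUm s)).enorm.pow_const p
  -- Level `n` has `T 2^n` increments, each with `p`-th moment at most `K 4^{-n}`. The weight `√2^n`
  -- leaves a summable `(1/√2)^n` in mean, and pathwise forces increments of size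
  -- `O((√2^{-1/p})^n)`.
  let S : ℕ → Ω → ENNReal := fun T ω => ∑' n : ℕ, ∑ k ∈ Finset.range (T * 2 ^ n),
    ENNReal.ofReal (√2 ^ n) * ‖U (((k + 1 : ℕ) : ℝ) / 2 ^ n) ω - U ((k : ℝ) / 2 ^ n) ω‖ₑ ^ p
  have hSm (T : ℕ) : Measurable (S T) := by
    exact Measurable.tsum fun n => Finset.measurable_fun_sum _ fun k _ => (hm _ _).const_mul _
  have hs2 : (0 : ℝ) < √2 := by positivity
  have hSint (T : ℕ) : ∫⁻ ω, S T ω ∂P ≠ ⊤ := by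
    have hterm (n : ℕ) : ∫⁻ ω, (∑ k ∈ Finset.range (T * 2 ^ n), ENNReal.ofReal (√2 ^ n) *
        ‖U (((k + 1 : ℕ) : ℝ) / 2 ^ n) ω - U ((k : ℝ) / 2 ^ n) ω‖ₑ ^ p) ∂P
        ≤ T * K * ENNReal.ofReal ((1 / √2) ^ n) := by
      rw [lintegral_finsetSum _ fun k _ => (hm _ _).const_mul _]
      calc _ ≤ ∑ k ∈ Finset.range (T * 2 ^ n),
            ENNReal.ofReal (√2 ^ n) * (K * ENNReal.ofReal (((1 / 2) ^ n) ^ 2)) := by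
            refine Finset.sum_le_sum fun k _ => ?_
            rw [lintegral_const_mul _ (hm _ _)]
            gcongr
            refine (hincU _ _ (by positivity) (by positivity)).trans_eq ?_
            congr 3
            rw [show ((k + 1 : ℕ) : ℝ) / 2 ^ n - (k : ℝ) / 2 ^ n = (1 / 2) ^ n by
              push_cast; rw [one_div, inv_pow]; ring, abs_of_pos (by positivity)]
        _ = T * K * ENNReal.ofReal ((1 / √2) ^ n) := by
            rw [Finset.sum_const, Finset.card_range, nsmul_eq_mul]
            have h4 : (1 / √2) ^ n = 2 ^ n * (√2 ^ n * ((1 / 2) ^ n) ^ 2) := by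
              rw [← pow_mul, mul_comm n 2, pow_mul, ← mul_pow, ← mul_pow]
              congr 1
              have := Real.mul_self_sqrt (show (0 : ℝ) ≤ 2 by norm_num)
              field_simp
              nlinarith
            rw [h4, ENNReal.ofReal_mul (by positivity), ENNReal.ofReal_mul (by positivity)]
            rw [show ENNReal.ofReal (2 ^ n) = 2 ^ n by
              rw [ENNReal.ofReal_pow (by norm_num)]; norm_num]
            push_cast
            ring
    refine ne_top_of_le_ne_top (b := ∑' n : ℕ, T * K * ENNReal.ofReal ((1 / √2) ^ n)) ?_ ?_
    · rw [ENNReal.tsum_mul_left]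
      refine ENNReal.mul_ne_top (ENNReal.mul_ne_top (by simp) hK) ?_
      rw [← ENNReal.ofReal_tsum_of_nonneg (fun n => by positivity)]
      · exact ENNReal.ofReal_ne_top
      · refine summable_geometric_of_lt_one (by positivity) ?_
        rw [div_lt_one hs2]
        exact Real.lt_sqrt_of_sq_lt (by norm_num)
    · refine (lintegral_tsum fun n => (Finset.measurable_fun_sum _ fun k _ =>
        (hm _ _).const_mul _).aemeasurable).trans_le ?_
      exact ENNReal.tsum_le_tsum hterm
  let G : Set Ω := {ω | ∀ T, S T ω < ⊤}
  have hG : MeasurableSet G := by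
    have : G = ⋂ T, {ω | S T ω < ⊤} := by ext; simp [G]
    rw [this]
    exact MeasurableSet.iInter fun T => measurableSet_lt (hSm T) measurable_const
  have hGae : ∀ᵐ ω ∂P, ω ∈ G := ae_all_iff.2 fun T => ae_lt_top (hSm T) (hSint T)
  -- Setting the process to zero off the measurable good event makes the limit exist for every `ω`,
  -- which keeps it measurable.
  have hpath (ω : Ω) : ∃ w : ℝ → ℝ, Continuous w ∧
      ∀ t, Tendsto (fun n => G.indicator (U (dyadic n t)) ω) atTop (𝓝 (w t)) := by
    by_cases hω : ω ∈ G
    · simp only [Set.indicator_of_mem hω]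
      have hr : (√2 : ℝ) ^ (-1 / p) < 1 :=
        Real.rpow_lt_one_of_one_lt_of_neg (Real.lt_sqrt_of_sq_lt (by norm_num))
          (div_neg_of_neg_of_pos (by norm_num) hp)
      refine exists_continuous_limit_of_dyadic_increments (v := fun t => U t ω)
        (Real.rpow_pos_of_pos hs2 (-1 / p)) hr fun T => ⟨(S T ω).toReal ^ (1 / p), ?_⟩
      intro n k hk
      set D := |U (((k + 1 : ℕ) : ℝ) / 2 ^ n) ω - U ((k : ℝ) / 2 ^ n) ω| with hD
      have hle : ENNReal.ofReal (√2 ^ n) * ENNReal.ofReal D ^ p ≤ S T ω := by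
        refine le_trans ?_ (ENNReal.le_tsum n)
        refine le_trans (le_of_eq ?_) (Finset.single_le_sum (f := fun k : ℕ =>
          ENNReal.ofReal (√2 ^ n) *
            ‖U (((k + 1 : ℕ) : ℝ) / 2 ^ n) ω - U ((k : ℝ) / 2 ^ n) ω‖ₑ ^ p)
          (fun _ _ => zero_le) (Finset.mem_range.2 hk))
        rw [hD, ← Real.norm_eq_abs, ofReal_norm]
      rw [ENNReal.ofReal_rpow_of_nonneg (abs_nonneg _) hp.le, ← ENNReal.ofReal_mul (by positivity),
        ← ENNReal.ofReal_toReal (hω T).ne, ENNReal.ofReal_le_ofReal_iff ENNReal.toReal_nonneg]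
        at hle
      have hD0 : 0 ≤ D := abs_nonneg _
      have h1 : D ^ p ≤ (S T ω).toReal * (√2 ^ n)⁻¹ := by
        rw [← div_eq_mul_inv, le_div_iff₀ (by positivity), mul_comm]
        exact hle
      calc D = (D ^ p) ^ (1 / p) := by
            rw [← Real.rpow_mul hD0, mul_one_div_cancel hp.ne', Real.rpow_one]
        _ ≤ ((S T ω).toReal * (√2 ^ n)⁻¹) ^ (1 / p) :=
            Real.rpow_le_rpow (by positivity) h1 (by positivity)
        _ = (S T ω).toReal ^ (1 / p) * (√2 ^ (-1 / p)) ^ n := by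
            rw [Real.mul_rpow ENNReal.toReal_nonneg (by positivity)]
            congr 1
            rw [← Real.rpow_natCast, ← Real.rpow_neg hs2.le, ← Real.rpow_mul hs2.le,
              ← Real.rpow_natCast (√2 ^ (-1 / p)), ← Real.rpow_mul hs2.le]
            congr 1
            ring
    · simp only [Set.indicator_of_notMem hω]
      exact ⟨fun _ => 0, continuous_const, fun _ => tendsto_const_nhds⟩
  choose w hwc hwlim using hpath
  have hWm (t : ℝ) : Measurable fun ω => w ω t :=
    measurable_of_tendsto_metrizable (fun n => (hUm (dyadic n t)).indicator hG)
      (tendsto_pi_nhds.2 fun ω => hwlim ω t)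
  refine ⟨fun t ω => w ω t, hWm, hwc, fun t ht => ?_⟩
  refine EventuallyEq.trans ?_ (hUV t ht)
  -- Fatou along the dyadic approximations of `t`, whose increments to `t` vanish in `p`-th mean.
  have hzero : ∫⁻ ω, ‖w ω t - U t ω‖ₑ ^ p ∂P = 0 := by
    have hlim : ∀ᵐ ω ∂P, Tendsto (fun n => ‖U (dyadic n t) ω - U t ω‖ₑ ^ p) atTop
        (𝓝 (‖w ω t - U t ω‖ₑ ^ p)) := by
      filter_upwards [hGae] with ω hω
      have := hwlim ω t
      simp only [Set.indicator_of_mem hω] at this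
      exact ((ENNReal.continuous_rpow_const (y := p)).tendsto _).comp
        (this.sub_const (U t ω)).enorm
    have h1 : ∫⁻ ω, ‖w ω t - U t ω‖ₑ ^ p ∂P
        ≤ liminf (fun n => ∫⁻ ω, ‖U (dyadic n t) ω - U t ω‖ₑ ^ p ∂P) atTop := by
      refine le_of_eq_of_le (lintegral_congr_ae ?_)
        (lintegral_liminf_le fun n => ((hUm _).sub (hUm t)).enorm.pow_const p)
      filter_upwards [hlim] with ω hω
      exact hω.liminf_eq.symm
    have h2 : Tendsto (fun n => ∫⁻ ω, ‖U (dyadic n t) ω - U t ω‖ₑ ^ p ∂P) atTop (𝓝 0) := by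
      have hup : Tendsto (fun n : ℕ => K * ENNReal.ofReal (((1 / 2 : ℝ) ^ n) ^ 2)) atTop
          (𝓝 (K * ENNReal.ofReal (0 ^ 2))) := by
        refine ENNReal.Tendsto.const_mul (ENNReal.tendsto_ofReal ?_) (Or.inr hK)
        exact (tendsto_pow_atTop_nhds_zero_of_lt_one (by norm_num) (by norm_num)).pow 2
      rw [zero_pow two_ne_zero, ENNReal.ofReal_zero, mul_zero] at hup
      refine tendsto_of_tendsto_of_tendsto_of_le_of_le tendsto_const_nhds hup
        (fun _ => zero_le) fun n => ?_
      refine (hincU t (dyadic n t) ht (dyadic_nonneg n t)).trans ?_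
      gcongr
      exact abs_dyadic_sub_le n ht
    rw [h2.liminf_eq] at h1
    exact le_antisymm h1 zero_le
  have hzero := (lintegral_eq_zero_iff (((hWm t).sub (hUm t)).enorm.pow_const p)).1 hzero
  filter_upwards [hzero] with ω hω
  have : ‖w ω t - U t ω‖ₑ = 0 := (ENNReal.rpow_eq_zero_iff_of_pos hp).1 hω
  rwa [enorm_eq_zero, sub_eq_zero] at this

end Kolmogorov

/-! ### Fourier series of periodic filters -/

section Fourier

lemma tendsto_Icc_neg_natCast :
    Tendsto (fun M : ℕ => Finset.Icc (-(M : ℤ)) M) atTop atTop := by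
  refine tendsto_atTop_finset_of_monotone (fun M N h => ?_) fun n => ⟨n.natAbs, ?_⟩
  · exact Finset.Icc_subset_Icc (by simpa using h) (by simpa using h)
  · rw [Finset.mem_Icc]
    omega

lemma ae_real_of_ae_addCircle {T : ℝ} [hT : Fact (0 < T)] {p : AddCircle T → Prop}
    (h : ∀ᵐ x ∂(volume : Measure (AddCircle T)), p x) : ∀ᵐ x : ℝ, p x := by
  have := iUnion_Ioc_add_zsmul hT.out 0
  rw [← Measure.restrict_univ (μ := (volume : Measure ℝ)), ← this, ae_restrict_iUnion_iff]
  intro n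
  have hmp := (AddCircle.measurePreserving_mk T (0 + n • T)).quasiMeasurePreserving.ae h
  rwa [show 0 + n • T + T = 0 + (n + 1) • T by rw [add_smul, one_smul, add_assoc]] at hmp

/-- Along a subsequence of any given sequence, the symmetric partial sums of the Fourier series of
a square integrable periodic function converge almost everywhere. -/
lemma exists_seq_tendsto_fourierSum {H : ℝ → ℂ} (hper : Function.Periodic H (2 * Real.pi))
    (hH : MemLp H 2 (volume.restrict (Set.Ioc (-Real.pi) Real.pi))) {c : ℤ → ℂ}
    (hc : ∀ n : ℤ, c n = (1 / (2 * Real.pi) : ℂ) *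
      ∫ x in (-Real.pi)..Real.pi, H x * Complex.exp (-Complex.I * n * x))
    {ns : ℕ → ℕ} (hns : StrictMono ns) :
    ∃ ms : ℕ → ℕ, StrictMono ms ∧ ∀ᵐ x : ℝ, Tendsto (fun l =>
      ∑ n ∈ Finset.Icc (-(ns (ms l) : ℤ)) (ns (ms l)), c n * Complex.exp (Complex.I * n * x))
      atTop (𝓝 (H x)) := by
  have hT : Fact (0 < 2 * Real.pi) := ⟨Real.two_pi_pos⟩
  have hend : -Real.pi + 2 * Real.pi = Real.pi := by ring
  set f : AddCircle (2 * Real.pi) → ℂ := AddCircle.liftIoc (2 * Real.pi) (-Real.pi) H with hfdef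
  have hf : MemLp f 2 AddCircle.haarAddCircle := by
    refine memLp_haarAddCircle_iff.2 (MemLp.memLp_liftIoc ?_)
    rwa [hend]
  have hfH (x : ℝ) : f x = H x := by
    have hx := toIocMod_mem_Ioc Real.two_pi_pos (-Real.pi) x
    have hcoe : ((toIocMod Real.two_pi_pos (-Real.pi) x : ℝ) : AddCircle (2 * Real.pi)) = x := by
      rw [toIocMod, AddCircle.coe_sub, AddCircle.coe_zsmul, AddCircle.coe_period, smul_zero,
        sub_zero]
    rw [← hcoe, hfdef, AddCircle.liftIoc_coe_apply hx, toIocMod, hper.sub_zsmul_eq]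
  have hcoeff (n : ℤ) : fourierCoeff (hf.toLp f) n = c n := by
    rw [fourierCoeff_congr_ae hf.coeFn_toLp, fourierCoeff_eq_intervalIntegral f n (-Real.pi), hend,
      hc n]
    rw [Complex.real_smul]
    congr 1
    · push_cast
      rfl
    · refine intervalIntegral.integral_congr fun x _ => ?_
      simp only [smul_eq_mul]
      rw [hfH, fourier_coe_apply, mul_comm]
      congr 2
      have : (Real.pi : ℂ) ≠ 0 := by exact_mod_cast Real.pi_ne_zero
      push_cast
      field_simp
  have hsum := (hasSum_fourier_series_L2 (hf.toLp f)).comp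
    (tendsto_Icc_neg_natCast.comp hns.tendsto_atTop)
  obtain ⟨ms, hms, hae⟩ := (tendstoInMeasure_of_tendsto_Lp hsum).exists_seq_tendsto_ae
  refine ⟨ms, hms, ?_⟩
  have hae2 : ∀ᵐ x ∂(AddCircle.haarAddCircle (T := 2 * Real.pi)), Tendsto (fun l =>
      ∑ n ∈ Finset.Icc (-(ns (ms l) : ℤ)) (ns (ms l)), c n * fourier n x) atTop (𝓝 (f x)) := by
    have hpart : ∀ᵐ x ∂(AddCircle.haarAddCircle (T := 2 * Real.pi)), ∀ l : ℕ,
        (∑ n ∈ Finset.Icc (-(ns (ms l) : ℤ)) (ns (ms l)),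
          fourierCoeff (hf.toLp f) n • fourierLp 2 n : Lp ℂ 2 AddCircle.haarAddCircle) x
          = ∑ n ∈ Finset.Icc (-(ns (ms l) : ℤ)) (ns (ms l)),
            fourierCoeff (hf.toLp f) n * fourier n x :=
      ae_all_iff.2 fun l => coeFn_sum_smul _ _ fun n => coeFn_fourierLp 2 n
    filter_upwards [hae, hf.coeFn_toLp, hpart] with x h1 h2 h3
    rw [← h2]
    refine h1.congr fun l => ?_
    refine (h3 l).trans (Finset.sum_congr rfl fun n _ => ?_)
    rw [hcoeff]
  have hae3 : ∀ᵐ x : AddCircle (2 * Real.pi), Tendsto (fun l =>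
      ∑ n ∈ Finset.Icc (-(ns (ms l) : ℤ)) (ns (ms l)), c n * fourier n x) atTop (𝓝 (f x)) := by
    rw [AddCircle.volume_eq_smul_haarAddCircle]
    exact Measure.ae_smul_measure hae2 _
  filter_upwards [ae_real_of_ae_addCircle hae3] with x hx
  rw [hfH] at hx
  refine hx.congr fun l => Finset.sum_congr rfl fun n _ => ?_
  rw [fourier_coe_apply]
  congr 2
  have : (Real.pi : ℂ) ≠ 0 := by exact_mod_cast Real.pi_ne_zero
  push_cast
  field_simp

/-- The transfer function of the even or odd part of a filter, shifted by `k` and downsampled. -/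
def downsample (h : ℝ → ℂ) (k : ℤ) (y : ℝ) : ℂ :=
  Complex.exp (Complex.I * k * ((y / 2 : ℝ) : ℂ)) *
    (h (y / 2) + (-1) ^ k * h (y / 2 + Real.pi)) / 2

lemma exp_int_mul_add_pi (m : ℤ) (z : ℝ) :
    Complex.exp (Complex.I * m * ((z + Real.pi : ℝ) : ℂ))
      = (-1) ^ m * Complex.exp (Complex.I * m * z) := by
  have h : Complex.I * m * ((z + Real.pi : ℝ) : ℂ)
      = m * (Real.pi * Complex.I) + Complex.I * m * z := by
    push_cast
    ring
  rw [h, Complex.exp_add, Complex.exp_int_mul, Complex.exp_pi_mul_I]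

lemma downsample_periodic {h : ℝ → ℂ} (hper : Function.Periodic h (2 * Real.pi)) (k : ℤ) :
    Function.Periodic (downsample h k) (2 * Real.pi) := by
  intro y
  have e1 : (y + 2 * Real.pi) / 2 = y / 2 + Real.pi := by ring
  have e2 : y / 2 + Real.pi + Real.pi = y / 2 + 2 * Real.pi := by ring
  have e3 : ((-1 : ℂ) ^ k) * (-1) ^ k = 1 := by
    rw [← mul_zpow]
    simp
  unfold downsample
  rw [e1, exp_int_mul_add_pi, e2, hper]
  linear_combination (Complex.exp (Complex.I * k * ((y / 2 : ℝ) : ℂ)) * h (y / 2) / 2) * e3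

lemma measurable_downsample {h : ℝ → ℂ} (hm : Measurable h) (k : ℤ) :
    Measurable (downsample h k) := by
  unfold downsample
  have h1 : Measurable fun y : ℝ => h (y / 2) := hm.comp (by fun_prop)
  have h2 : Measurable fun y : ℝ => h (y / 2 + Real.pi) := hm.comp (by fun_prop)
  fun_prop

lemma norm_exp_I_mul (k : ℤ) (x : ℝ) : ‖Complex.exp (Complex.I * k * x)‖ = 1 := by
  rw [show Complex.I * k * x = ((k * x : ℝ) : ℂ) * Complex.I by push_cast; ring,
    Complex.norm_exp_ofReal_mul_I]

lemma norm_downsample_le {h : ℝ → ℂ} {C : ℝ} (hC : ∀ x, ‖h x‖ ≤ C) (k : ℤ) (y : ℝ) :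
    ‖downsample h k y‖ ≤ C := by
  unfold downsample
  rw [norm_div, norm_mul, norm_exp_I_mul, one_mul]
  have h1 : ‖((-1 : ℂ) ^ k) * h (y / 2 + Real.pi)‖ ≤ C := by
    rw [norm_mul, norm_zpow]
    simpa using hC _
  have h2 := norm_add_le (h (y / 2)) ((-1) ^ k * h (y / 2 + Real.pi))
  have h3 := hC (y / 2)
  rw [RCLike.norm_ofNat, div_le_iff₀ two_pos]
  linarith

lemma intervalIntegrable_of_bounded {h : ℝ → ℂ} (hm : Measurable h) {C : ℝ}
    (hC : ∀ x, ‖h x‖ ≤ C) (a b : ℝ) : IntervalIntegrable h volume a b := by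
  refine (intervalIntegrable_const (c := C)).mono_fun hm.aestronglyMeasurable
    (ae_of_all _ fun x => ?_)
  exact (hC x).trans (Real.norm_eq_abs C ▸ le_abs_self C)

/-- The substitution `z = x/2` maps the period to `[-π/2, π/2]`; the term shifted by `π` supplies
the other half. Hence the taps of one parity are the Fourier coefficients of the downsampled filter.
-/
lemma timeFilter_eq_downsample {h : ℝ → ℂ} (hper : Function.Periodic h (2 * Real.pi))
    (hm : Measurable h) {C : ℝ} (hC : ∀ x, ‖h x‖ ≤ C) (k n : ℤ) :
    timeFilter h (k - 2 * n) = (1 / (2 * Real.pi) : ℂ) *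
      ∫ x in (-Real.pi)..Real.pi, downsample h k x * Complex.exp (-Complex.I * n * x) := by
  unfold timeFilter
  congr 1
  set q : ℝ → ℂ := fun z => h z * Complex.exp (Complex.I * ((k - 2 * n : ℤ) : ℂ) * z) with hq
  have hqper : Function.Periodic q (2 * Real.pi) := by
    intro z
    simp only [hq]
    rw [hper]
    congr 1
    rw [show z + 2 * Real.pi = z + Real.pi + Real.pi by ring, exp_int_mul_add_pi,
      exp_int_mul_add_pi, ← mul_assoc, ← mul_zpow]
    simp
  have hqm : Measurable q := by
    simp only [hq]
    fun_prop
  have hqC (z : ℝ) : ‖q z‖ ≤ C := by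
    simp only [hq]
    rw [norm_mul, norm_exp_I_mul, mul_one]
    exact hC z
  have hqi (a b : ℝ) : IntervalIntegrable q volume a b := intervalIntegrable_of_bounded hqm hqC a b
  have hqi' (a b : ℝ) : IntervalIntegrable (fun z => q (z + Real.pi)) volume a b :=
    intervalIntegrable_of_bounded (hqm.comp (by fun_prop)) (fun z => hqC _) a b
  have hpt (z : ℝ) : downsample h k z * Complex.exp (-Complex.I * n * z)
      = (q (z / 2) + q (z / 2 + Real.pi)) / 2 := by
    simp only [hq, downsample]
    rw [exp_int_mul_add_pi]
    have e1 : ((-1 : ℂ) ^ (k - 2 * n)) = (-1) ^ k := by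
      rw [zpow_sub₀ (by norm_num), zpow_mul]
      simp
    have e2 : Complex.exp (Complex.I * ((k - 2 * n : ℤ) : ℂ) * ((z / 2 : ℝ) : ℂ))
        = Complex.exp (Complex.I * k * ((z / 2 : ℝ) : ℂ)) *
          Complex.exp (-Complex.I * n * z) := by
      rw [← Complex.exp_add]
      congr 1
      push_cast
      ring
    rw [e1, e2]
    ring
  symm
  calc ∫ x in (-Real.pi)..Real.pi, downsample h k x * Complex.exp (-Complex.I * n * x)
      = ∫ x in (-Real.pi)..Real.pi, (fun z => (q z + q (z + Real.pi)) / 2) (x / 2) :=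
        intervalIntegral.integral_congr fun x _ => hpt x
    _ = ∫ z in (-Real.pi / 2)..(Real.pi / 2), (q z + q (z + Real.pi)) := by
        rw [intervalIntegral.integral_comp_div (fun z => (q z + q (z + Real.pi)) / 2) two_ne_zero,
          intervalIntegral.integral_div, Complex.real_smul]
        push_cast
        ring
    _ = (∫ z in (-Real.pi / 2)..(Real.pi / 2), q z)
          + ∫ z in (Real.pi / 2)..(-Real.pi / 2 + 2 * Real.pi), q z := by
        rw [intervalIntegral.integral_add (hqi _ _) (hqi' _ _),
          intervalIntegral.integral_comp_add_right]
        congr 2 <;> ring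
    _ = ∫ z in (-Real.pi / 2)..(-Real.pi / 2 + 2 * Real.pi), q z :=
        intervalIntegral.integral_add_adjacent_intervals (hqi _ _) (hqi _ _)
    _ = ∫ z in (-Real.pi)..(-Real.pi + 2 * Real.pi), q z := hqper.intervalIntegral_add_eq _ _
    _ = ∫ z in (-Real.pi)..Real.pi, q z := by
        congr 1
        ring

lemma exists_seq_tendsto_downsample {h : ℝ → ℂ} (hper : Function.Periodic h (2 * Real.pi))
    (hm : Measurable h) {C : ℝ} (hC : ∀ x, ‖h x‖ ≤ C) (k : ℤ) {ns : ℕ → ℕ} (hns : StrictMono ns) :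
    ∃ ms : ℕ → ℕ, StrictMono ms ∧ ∀ᵐ x : ℝ, Tendsto (fun l =>
      ∑ n ∈ Finset.Icc (-(ns (ms l) : ℤ)) (ns (ms l)),
        timeFilter h (k - 2 * n) * Complex.exp (Complex.I * n * x))
      atTop (𝓝 (downsample h k x)) :=
  exists_seq_tendsto_fourierSum (downsample_periodic hper k)
    (MemLp.of_bound (measurable_downsample hm k).aestronglyMeasurable C
      (ae_of_all _ (norm_downsample_le hC k)))
    (timeFilter_eq_downsample hper hm hC k) hns

end Fourier

/-! ### Meyer filters and truncated filters -/

section Filters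

/-- A positive spectral filter, continuous off the origin, that is `O(|x|^{-e})` at the origin and
`O(|x|^{-1-d})` at infinity. -/
structure IsRegularFilter (ghat : ℝ → ℝ) (C d e : ℝ) : Prop where
  neg_half_lt : -(1 / 2) < d
  lt_half : d < 1 / 2
  exponent_lt_half : e < 1 / 2
  pos : ∀ x, x ≠ 0 → 0 < ghat x
  continuousOn : ContinuousOn ghat {0}ᶜ
  le_near : ∀ x, x ≠ 0 → |x| ≤ 1 → ghat x ≤ C * |x| ^ (-e)
  le_far : ∀ x, 1 ≤ |x| → ghat x ≤ C * |x| ^ (-1 - d)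

namespace IsRegularFilter

variable {ghat : ℝ → ℝ} {C d e : ℝ}

lemma measurable (hg : IsRegularFilter ghat C d e) : Measurable ghat :=
  measurable_of_continuousOn_compl_singleton 0 hg.continuousOn

lemma const_pos (hg : IsRegularFilter ghat C d e) : 0 < C := by
  have h1 := hg.le_far 1 (by simp)
  have h2 := hg.pos 1 one_ne_zero
  simp only [abs_one, Real.one_rpow, mul_one] at h1
  exact h2.trans_le h1

lemma norm_le_const (hg : IsRegularFilter ghat C d e) {x : ℝ} (hx : 1 ≤ |x|) : |ghat x| ≤ C := by
  have hx0 : x ≠ 0 := by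
    rintro rfl
    norm_num at hx
  rw [abs_of_pos (hg.pos x hx0)]
  refine (hg.le_far x hx).trans (mul_le_of_le_one_right hg.const_pos.le ?_)
  exact Real.rpow_le_one_of_one_le_of_nonpos hx (by linarith [hg.neg_half_lt])

end IsRegularFilter

namespace IsMeyerFilter

variable {uhat : ℝ → ℝ}

lemma sq_le (hu : IsMeyerFilter uhat) (x : ℝ) : uhat x ^ 2 ≤ 2 := by
  have := hu.mirror x
  nlinarith [sq_nonneg (uhat (x + Real.pi))]

lemma abs_le (hu : IsMeyerFilter uhat) (x : ℝ) : |uhat x| ≤ √2 :=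
  Real.abs_le_sqrt (hu.sq_le x)

lemma eq_zero_of_abs_le (hu : IsMeyerFilter uhat) {x : ℝ} (h1 : 2 * Real.pi / 3 ≤ |x|)
    (h2 : |x| ≤ 4 * Real.pi / 3) : uhat x = 0 := by
  have hpi := Real.pi_pos
  rcases le_total |x| Real.pi with h | h
  · exact hu.null_band x h1 h
  rcases le_total 0 x with hx | hx
  · rw [abs_of_nonneg hx] at h2 h
    rw [← hu.periodic.sub_eq x]
    refine hu.null_band _ ?_ ?_ <;> rw [abs_of_nonpos (by linarith)] <;> linarith
  · rw [abs_of_nonpos hx] at h2 h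
    rw [← hu.periodic x]
    refine hu.null_band _ ?_ ?_ <;> rw [abs_of_nonneg (by linarith)] <;> linarith

lemma scalingHat_eq_one (hu : IsMeyerFilter uhat) {x : ℝ} (h : |x| ≤ 2 * Real.pi / 3) :
    scalingHat uhat x = 1 := by
  have hpi := Real.pi_pos
  rw [scalingHat, if_pos (by linarith), hu.pass_band]
  · exact div_self (by positivity)
  · rw [abs_div, abs_two]
    linarith

lemma abs_scalingHat_le (hu : IsMeyerFilter uhat) (x : ℝ) : |scalingHat uhat x| ≤ 1 := by
  unfold scalingHat
  split_ifs
  · rw [abs_div, abs_of_pos (show (0 : ℝ) < √2 by positivity), div_le_one (by positivity)]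
    exact hu.abs_le _
  · simp

/-- The two-scale equation. -/
lemma scalingHat_eq (hu : IsMeyerFilter uhat) (x : ℝ) :
    scalingHat uhat x = uhat (x / 2) * scalingHat uhat (x / 2) / √2 := by
  have hpi := Real.pi_pos
  have habs : |x / 2| = |x| / 2 := by rw [abs_div, abs_two]
  by_cases h1 : |x| ≤ 4 * Real.pi / 3
  · rw [hu.scalingHat_eq_one (x := x / 2) (by rw [habs]; linarith), scalingHat, if_pos h1, mul_one]
  · have h0 : scalingHat uhat x = 0 := by rw [scalingHat, if_neg h1]
    rw [h0]
    by_cases h2 : |x| ≤ 8 * Real.pi / 3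
    · rw [hu.eq_zero_of_abs_le (x := x / 2)] <;> [simp; rw [habs]; rw [habs]] <;> linarith
    · rw [scalingHat, if_neg (by rw [habs]; linarith)]
      simp

end IsMeyerFilter

/-- Reduction modulo `2π` to `[-π, π)`. -/
def redMod (x : ℝ) : ℝ := toIcoMod Real.two_pi_pos (-Real.pi) x

lemma redMod_mem (x : ℝ) : -Real.pi ≤ redMod x ∧ redMod x < Real.pi := by
  have h := toIcoMod_mem_Ico Real.two_pi_pos (-Real.pi) x
  exact ⟨h.1, by linarith [h.2, show redMod x = toIcoMod Real.two_pi_pos (-Real.pi) x from rfl]⟩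

lemma abs_redMod_le (x : ℝ) : |redMod x| ≤ Real.pi :=
  abs_le.2 ⟨(redMod_mem x).1, (redMod_mem x).2.le⟩

lemma exists_redMod_eq (x : ℝ) : ∃ n : ℤ, redMod x = x - n * (2 * Real.pi) :=
  ⟨toIcoDiv Real.two_pi_pos (-Real.pi) x, by rw [redMod, toIcoMod, zsmul_eq_mul]⟩

lemma redMod_of_mem {x : ℝ} (h1 : -Real.pi ≤ x) (h2 : x < Real.pi) : redMod x = x :=
  (toIcoMod_eq_self Real.two_pi_pos).2 ⟨h1, by linarith⟩

lemma redMod_periodic : Function.Periodic redMod (2 * Real.pi) :=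
  fun x => toIcoMod_add_right Real.two_pi_pos (-Real.pi) x

lemma measurable_redMod : Measurable redMod := by
  have : redMod = fun x => x - (⌊(x - -Real.pi) / (2 * Real.pi)⌋ : ℝ) * (2 * Real.pi) := by
    ext x
    rw [redMod, toIcoMod, toIcoDiv_eq_floor, zsmul_eq_mul]
  rw [this]
  fun_prop

lemma apply_redMod {E : Type*} {h : ℝ → E} (hper : Function.Periodic h (2 * Real.pi)) (x : ℝ) :
    h (redMod x) = h x := by
  rw [redMod, toIcoMod, hper.sub_zsmul_eq]

lemma redMod_ne_zero_ae : ∀ᵐ x : ℝ, redMod x ≠ 0 := by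
  have hc : (Set.range fun n : ℤ => (n : ℝ) * (2 * Real.pi)).Countable := Set.countable_range _
  filter_upwards [hc.ae_notMem volume] with x hx h
  obtain ⟨n, hn⟩ := exists_redMod_eq x
  exact hx ⟨n, by simp only; linarith⟩

lemma truncatedFilter_eq (ghat : ℝ → ℝ) (j : ℕ) (x : ℝ) :
    truncatedFilter ghat j x = √(2 * Real.pi) * ghat (2 ^ j * redMod x) := rfl

lemma truncatedFilter_periodic (ghat : ℝ → ℝ) (j : ℕ) :
    Function.Periodic (truncatedFilter ghat j) (2 * Real.pi) := fun x => by
  rw [truncatedFilter_eq, truncatedFilter_eq, redMod_periodic]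

variable {ghat uhat : ℝ → ℝ} {C d e : ℝ}

lemma measurable_truncatedFilter (hg : IsRegularFilter ghat C d e) (j : ℕ) :
    Measurable (truncatedFilter ghat j) := by
  have := hg.measurable.comp (measurable_redMod.const_mul ((2 : ℝ) ^ j))
  exact this.const_mul _

lemma truncatedFilter_ne_zero_ae (hg : IsRegularFilter ghat C d e) (j : ℕ) :
    ∀ᵐ x : ℝ, truncatedFilter ghat j x ≠ 0 := by
  filter_upwards [redMod_ne_zero_ae] with x hx
  rw [truncatedFilter_eq]
  have := hg.pos (2 ^ j * redMod x) (mul_ne_zero (by positivity) hx)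
  have := Real.pi_pos
  positivity

lemma lowFilter_periodic (hu : IsMeyerFilter uhat) (j : ℕ) :
    Function.Periodic (lowFilter ghat uhat j) (2 * Real.pi) := fun x => by
  have h2 : truncatedFilter ghat j (2 * (x + 2 * Real.pi)) = truncatedFilter ghat j (2 * x) := by
    rw [show 2 * (x + 2 * Real.pi) = 2 * x + 2 * Real.pi + 2 * Real.pi by ring,
      truncatedFilter_periodic, truncatedFilter_periodic]
  simp only [lowFilter]
  rw [h2, truncatedFilter_periodic, hu.periodic]

lemma exp_neg_I_add_two_pi (x : ℝ) :
    Complex.exp (-Complex.I * ((x + 2 * Real.pi : ℝ) : ℂ)) = Complex.exp (-Complex.I * x) := by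
  rw [show -Complex.I * ((x + 2 * Real.pi : ℝ) : ℂ)
    = -Complex.I * x - 2 * Real.pi * Complex.I by push_cast; ring, Complex.exp_periodic.sub_eq]

lemma highPass_periodic (hu : IsMeyerFilter uhat) :
    Function.Periodic (highPass uhat) (2 * Real.pi) := fun x => by
  unfold highPass
  rw [exp_neg_I_add_two_pi, show x + 2 * Real.pi + Real.pi = x + Real.pi + 2 * Real.pi by ring,
    hu.periodic]

lemma highFilter_periodic (hu : IsMeyerFilter uhat) (j : ℕ) :
    Function.Periodic (highFilter ghat uhat j) (2 * Real.pi) := fun x => by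
  unfold highFilter
  rw [truncatedFilter_periodic, highPass_periodic hu]

lemma measurable_highPass (hu : IsMeyerFilter uhat) : Measurable (highPass uhat) := by
  have := hu.smooth.continuous
  unfold highPass
  exact (by fun_prop : Continuous fun x : ℝ =>
    Complex.exp (-Complex.I * x) * (uhat (x + Real.pi) : ℂ)).measurable

lemma measurable_lowFilter (hg : IsRegularFilter ghat C d e) (hu : IsMeyerFilter uhat) (j : ℕ) :
    Measurable (lowFilter ghat uhat j) := by
  have h1 := measurable_truncatedFilter hg (j + 1)
  have h2 := (measurable_truncatedFilter hg j).comp (measurable_const_mul (2 : ℝ))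
  exact Complex.measurable_ofReal.comp ((h1.div h2).mul hu.smooth.continuous.measurable)

lemma measurable_highFilter (hg : IsRegularFilter ghat C d e) (hu : IsMeyerFilter uhat) (j : ℕ) :
    Measurable (highFilter ghat uhat j) :=
  (Complex.measurable_ofReal.comp (measurable_truncatedFilter hg (j + 1))).mul
    (measurable_highPass hu)

lemma norm_highPass (x : ℝ) : ‖highPass uhat x‖ = |uhat (x + Real.pi)| := by
  rw [highPass, norm_mul, show -Complex.I * x = ((-x : ℝ) : ℂ) * Complex.I by push_cast; ring,
    Complex.norm_exp_ofReal_mul_I, one_mul, Complex.norm_real, Real.norm_eq_abs]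

/-- The factor `û(x + π)` vanishes near the origin, where `ĝ` may be singular; elsewhere the
argument of `ĝ` has modulus at least `1`. -/
lemma exists_norm_highFilter_le (hg : IsRegularFilter ghat C d e) (hu : IsMeyerFilter uhat)
    (j : ℕ) : ∃ K : ℝ, ∀ x, ‖highFilter ghat uhat j x‖ ≤ K := by
  have hpi := Real.pi_gt_three
  have hC := hg.const_pos
  refine ⟨√(2 * Real.pi) * C * √2, fun x => ?_⟩
  rw [← apply_redMod (highFilter_periodic hu j) x]
  set m := redMod x
  have hm := redMod_mem x
  have hmm : redMod m = m := redMod_of_mem hm.1 hm.2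
  rw [highFilter, norm_mul, norm_highPass, Complex.norm_real, Real.norm_eq_abs,
    truncatedFilter_eq, hmm]
  by_cases h : |m| ≤ Real.pi / 3
  · have h0 : uhat (m + Real.pi) = 0 := by
      have := abs_le.1 h
      refine hu.eq_zero_of_abs_le ?_ ?_ <;> rw [abs_of_nonneg (by linarith)] <;> linarith
    rw [h0, abs_zero, mul_zero]
    positivity
  · rw [abs_mul, abs_of_nonneg (Real.sqrt_nonneg _)]
    gcongr
    · refine hg.norm_le_const ?_
      have h2 : (1 : ℝ) ≤ 2 ^ (j + 1) := one_le_pow₀ one_le_two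
      rw [abs_mul, abs_of_pos (by positivity)]
      nlinarith
    · exact hu.abs_le _

/-- If `2x` needs no reduction modulo `2π`, both filters take the same value and any singularity or
zero at the origin cancels. If it does, the support of `û` gives `|x| < 2π/3`, so the reduced point
stays at distance at least `2π/3` from the origin and the denominator is bounded below by
compactness. -/
lemma exists_norm_lowFilter_le (hg : IsRegularFilter ghat C d e) (hu : IsMeyerFilter uhat)
    (j : ℕ) : ∃ K : ℝ, ∀ x, ‖lowFilter ghat uhat j x‖ ≤ K := by
  have hpi := Real.pi_gt_three
  have hC := hg.const_pos
  have h2j : (1 : ℝ) ≤ 2 ^ j := one_le_pow₀ one_le_two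
  obtain ⟨a, ha, hlow⟩ : ∃ a : ℝ, 0 < a ∧ ∀ y, 2 * Real.pi / 3 ≤ |y| → |y| ≤ Real.pi →
      a ≤ ghat (2 ^ j * y) := by
    have hK : IsCompact {y : ℝ | 2 * Real.pi / 3 ≤ |y| ∧ |y| ≤ Real.pi} := by
      refine IsCompact.of_isClosed_subset (isCompact_Icc (a := -Real.pi) (b := Real.pi)) ?_ ?_
      · exact (isClosed_le continuous_const continuous_abs).inter
          (isClosed_le continuous_abs continuous_const)
      · exact fun y hy => abs_le.1 hy.2
    have hne : ∀ y ∈ {y : ℝ | 2 * Real.pi / 3 ≤ |y| ∧ |y| ≤ Real.pi}, 2 ^ j * y ≠ 0 := by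
      intro y hy
      have : 0 < |y| := by linarith [hy.1]
      exact mul_ne_zero (by positivity) (abs_pos.1 this)
    have hcont : ContinuousOn (fun y => ghat (2 ^ j * y))
        {y : ℝ | 2 * Real.pi / 3 ≤ |y| ∧ |y| ≤ Real.pi} :=
      hg.continuousOn.comp (by fun_prop) hne
    obtain ⟨y₀, hy₀, hmin⟩ := hK.exists_isMinOn
      ⟨Real.pi, by simp only [Set.mem_ofPred_eq]; rw [abs_of_pos (by linarith)]; constructor <;>
        linarith⟩ hcont
    exact ⟨ghat (2 ^ j * y₀), hg.pos _ (hne _ hy₀), fun y h1 h2 => hmin ⟨h1, h2⟩⟩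
  refine ⟨(1 + C / a) * √2, fun x => ?_⟩
  rw [← apply_redMod (lowFilter_periodic hu j) x]
  set m := redMod x
  have hm := redMod_mem x
  have hmm : redMod m = m := redMod_of_mem hm.1 hm.2
  have habs : |m| ≤ Real.pi := abs_redMod_le x
  rw [lowFilter, Complex.norm_real, Real.norm_eq_abs, abs_mul]
  by_cases h : 2 * Real.pi / 3 ≤ |m|
  · rw [hu.null_band m h habs, abs_zero, mul_zero]
    positivity
  refine mul_le_mul ?_ (hu.abs_le m) (abs_nonneg _) (by positivity)
  rw [truncatedFilter_eq, truncatedFilter_eq, hmm,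
    mul_div_mul_left _ _ (by positivity : √(2 * Real.pi) ≠ 0)]
  obtain ⟨n, hn⟩ := exists_redMod_eq (2 * m)
  have hm2 := abs_redMod_le (2 * m)
  by_cases hn0 : n = 0
  · rw [hn, hn0, Int.cast_zero, zero_mul, sub_zero, show (2 : ℝ) ^ (j + 1) * m = 2 ^ j * (2 * m) by
      rw [pow_succ]; ring]
    have h1 : |ghat (2 ^ j * (2 * m)) / ghat (2 ^ j * (2 * m))| ≤ 1 := by
      by_cases hz : ghat (2 ^ j * (2 * m)) = 0
      · simp [hz]
      · rw [div_self hz, abs_one]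
    have h2 : 0 ≤ C / a := by positivity
    linarith
  · have hn1 : (1 : ℝ) ≤ |(n : ℝ)| := by exact_mod_cast Int.one_le_abs hn0
    have hb : 2 * Real.pi ≤ |redMod (2 * m)| + 2 * |m| := by
      have : (n : ℝ) * (2 * Real.pi) = 2 * m - redMod (2 * m) := by linarith
      have h3 : |(n : ℝ) * (2 * Real.pi)| ≤ |2 * m| + |redMod (2 * m)| := by
        rw [this]
        exact abs_sub _ _
      rw [abs_mul, abs_of_pos (show 0 < 2 * Real.pi by linarith), abs_mul, abs_two] at h3
      nlinarith
    have hlow' := hlow (redMod (2 * m)) (by linarith) hm2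
    have hup : |ghat (2 ^ (j + 1) * m)| ≤ C := by
      refine hg.norm_le_const ?_
      have h2 : (1 : ℝ) ≤ 2 ^ (j + 1) := one_le_pow₀ one_le_two
      rw [abs_mul, abs_of_pos (by positivity)]
      nlinarith
    rw [abs_div]
    have : |ghat (2 ^ (j + 1) * m)| / |ghat (2 ^ j * redMod (2 * m))| ≤ C / a := by
      gcongr
      exact hlow'.trans (le_abs_self _)
    linarith

/-- The algebraic identity behind the wavelet recursion. -/
lemma downsample_reconstruction (hu : IsMeyerFilter uhat) (j : ℕ) (k : ℤ) {y : ℝ}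
    (hy : truncatedFilter ghat j y ≠ 0) :
    downsample (lowFilter ghat uhat j) k y * (scalingHat uhat y * truncatedFilter ghat j y)
      + downsample (highFilter ghat uhat j) k y * (starRingEnd ℂ) (waveletHat uhat y)
    = Complex.exp (Complex.I * k * ((y / 2 : ℝ) : ℂ)) *
      (scalingHat uhat (y / 2) * truncatedFilter ghat (j + 1) (y / 2)) / √2 := by
  have h2 : 2 * (y / 2) = y := by ring
  have h3 : 2 * (y / 2 + Real.pi) = y + 2 * Real.pi := by ring
  have hp : truncatedFilter ghat j (y + 2 * Real.pi) = truncatedFilter ghat j y :=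
    truncatedFilter_periodic ghat j y
  have hupp : uhat (y / 2 + Real.pi + Real.pi) = uhat (y / 2) := by
    rw [show y / 2 + Real.pi + Real.pi = y / 2 + 2 * Real.pi by ring, hu.periodic]
  have hmir := hu.mirror (y / 2)
  have hexp : Complex.exp (-Complex.I * ((y / 2 + Real.pi : ℝ) : ℂ))
      = -Complex.exp (-Complex.I * ((y / 2 : ℝ) : ℂ)) := by
    have := exp_int_mul_add_pi (-1) (y / 2)
    simpa using this
  have hconj : (starRingEnd ℂ) (Complex.exp (-Complex.I * ((y / 2 : ℝ) : ℂ)))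
      * Complex.exp (-Complex.I * ((y / 2 : ℝ) : ℂ)) = 1 := by
    rw [← Complex.normSq_eq_conj_mul_self, Complex.normSq_eq_norm_sq,
      show -Complex.I * ((y / 2 : ℝ) : ℂ) = ((-(y / 2) : ℝ) : ℂ) * Complex.I by push_cast; ring,
      Complex.norm_exp_ofReal_mul_I]
    simp
  have hmirC : (uhat (y / 2) : ℂ) ^ 2 + (uhat (y / 2 + Real.pi) : ℂ) ^ 2 = 2 := by
    exact_mod_cast hmir
  have hyC : (truncatedFilter ghat j y : ℂ) ≠ 0 := by exact_mod_cast hy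
  have hs : ((√2 : ℝ) : ℂ) ≠ 0 := by
    simp
  unfold downsample lowFilter highFilter waveletHat highPass
  rw [h2, h3, hp, hupp, hexp, hu.scalingHat_eq y]
  simp only [map_div₀, map_mul, Complex.conj_ofReal]
  push_cast
  set E := Complex.exp (-Complex.I * ((y : ℂ) / 2)) with hE
  have hconj' : (starRingEnd ℂ) E * E = 1 := by
    rw [hE]
    simpa using hconj
  generalize (starRingEnd ℂ) E = E' at *
  generalize (truncatedFilter ghat (j + 1) (y / 2) : ℂ) = G at *
  generalize (truncatedFilter ghat (j + 1) (y / 2 + Real.pi) : ℂ) = G' at *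
  generalize (uhat (y / 2) : ℂ) = U at *
  generalize (uhat (y / 2 + Real.pi) : ℂ) = U' at *
  generalize (truncatedFilter ghat j y : ℂ) = H at *
  generalize (scalingHat uhat (y / 2) : ℂ) = Φ
  generalize Complex.exp (Complex.I * k * ((y : ℂ) / 2)) = F
  generalize ((-1 : ℂ) ^ k) = S
  field_simp
  -- The aliased terms in `G'` from the two channels cancel; the terms in `G` add up through the
  -- mirror identity.
  linear_combination (F * Φ * G) * hmirC + (F * U' * (G * U' - S * G' * U) * Φ) * hconj'

end Filters

/-! ### Spectral representation of the discretization sequences -/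

section Representation

lemma integrable_comp_abs {q : ℝ → ℝ} (hq : IntegrableOn q (Set.Ioi 0)) :
    Integrable fun x : ℝ => q |x| := by
  have h1 : IntegrableOn (fun x : ℝ => q |x|) (Set.Ioi 0) :=
    hq.congr_fun (fun x hx => by rw [abs_of_pos (Set.mem_Ioi.1 hx)]) measurableSet_Ioi
  have h2 : IntegrableOn (fun x : ℝ => q |x|) (Set.Iio 0) := by
    have hq' : IntegrableOn q (Set.Ioi (-0)) := by rwa [neg_zero]
    exact hq'.comp_neg_Iio.congr_fun (fun x hx => by rw [abs_of_neg (Set.mem_Iio.1 hx)])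
      measurableSet_Iio
  rw [← integrableOn_univ, ← Set.Iic_union_Ioi (a := (0 : ℝ))]
  exact ((integrableOn_Iic_iff_integrableOn_Iio (by simp)).2 h2).union h1

lemma memLp_two_of_power_bounds {a b C : ℝ} (ha : -(1 / 2) < a) (hb : b < -(1 / 2)) {w : ℝ → ℝ}
    (hw : AEStronglyMeasurable w volume) (hnear : ∀ x, x ≠ 0 → |x| ≤ 1 → |w x| ≤ C * |x| ^ a)
    (hfar : ∀ x, 1 ≤ |x| → |w x| ≤ C * |x| ^ b) : MemLp w 2 volume := by
  let q : ℝ → ℝ := fun r => if r ≤ 1 then C ^ 2 * r ^ (2 * a) else C ^ 2 * r ^ (2 * b)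
  have hq : IntegrableOn q (Set.Ioi 0) := by
    rw [← Set.Ioc_union_Ioi_eq_Ioi zero_le_one]
    refine IntegrableOn.union ?_ ?_
    · have h1 : IntegrableOn (fun r : ℝ => C ^ 2 * r ^ (2 * a)) (Set.Ioc 0 1) :=
        ((intervalIntegrable_iff_integrableOn_Ioc_of_le zero_le_one).1
          (intervalIntegral.intervalIntegrable_rpow' (by linarith))).const_mul _
      refine h1.congr_fun (fun r hr => ?_) measurableSet_Ioc
      simp only [q, if_pos hr.2]
    · have h1 : IntegrableOn (fun r : ℝ => C ^ 2 * r ^ (2 * b)) (Set.Ioi 1) :=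
        (integrableOn_Ioi_rpow_of_lt (by linarith) one_pos).const_mul _
      refine h1.congr_fun (fun r hr => ?_) measurableSet_Ioi
      simp only [q, if_neg (not_le.2 (Set.mem_Ioi.1 hr))]
  have hq' : Integrable fun x : ℝ => q |x| := integrable_comp_abs hq
  refine (memLp_two_iff_integrable_sq hw).2 (hq'.mono' (hw.pow 2) ?_)
  have h0 : ∀ᵐ x : ℝ, x ≠ 0 := (Set.countable_singleton (0 : ℝ)).ae_notMem volume
  filter_upwards [h0] with x hx
  have hx0 : 0 < |x| := abs_pos.2 hx
  rw [Real.norm_eq_abs, abs_pow]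
  simp only [q]
  split_ifs with h
  · calc |w x| ^ 2 ≤ (C * |x| ^ a) ^ 2 := pow_le_pow_left₀ (abs_nonneg _) (hnear x hx h) 2
      _ = C ^ 2 * |x| ^ (2 * a) := by
        rw [mul_pow, ← Real.rpow_natCast (|x| ^ a), ← Real.rpow_mul hx0.le]
        congr 2
        push_cast
        ring
  · calc |w x| ^ 2 ≤ (C * |x| ^ b) ^ 2 :=
          pow_le_pow_left₀ (abs_nonneg _) (hfar x (not_le.1 h).le) 2
      _ = C ^ 2 * |x| ^ (2 * b) := by
        rw [mul_pow, ← Real.rpow_natCast (|x| ^ b), ← Real.rpow_mul hx0.le]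
        congr 2
        push_cast
        ring

/-- At infinity the square decays like `|x|^{2(h-1-d)}`, which fixes the threshold `d + 1/2`; at the
origin `e < 1/2` suffices. -/
lemma IsRegularFilter.memLp_rpow_mul {ghat : ℝ → ℝ} {C d e : ℝ} (hg : IsRegularFilter ghat C d e)
    {h : ℝ} (h0 : 0 ≤ h) (hd : h < d + 1 / 2) : MemLp (fun x => |x| ^ h * ghat x) 2 volume := by
  have hm := hg.measurable
  have hpos (x : ℝ) (hx : x ≠ 0) : |(|x| ^ h * ghat x)| = ghat x * |x| ^ h := by
    have := hg.pos x hx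
    rw [abs_of_nonneg (by positivity), mul_comm]
  refine memLp_two_of_power_bounds (a := h - e) (b := h - 1 - d) (C := C)
    (by linarith [hg.exponent_lt_half]) (by linarith)
    (by fun_prop : Measurable _).aestronglyMeasurable (fun x hx hx1 => ?_) fun x hx1 => ?_
  · have hx0 : 0 < |x| := abs_pos.2 hx
    rw [hpos x hx, show h - e = -e + h by ring, Real.rpow_add hx0, ← mul_assoc]
    gcongr
    exact hg.le_near x hx hx1
  · have hx0 : 0 < |x| := by linarith
    rw [hpos x (abs_pos.1 hx0), show h - 1 - d = (-1 - d) + h by ring, Real.rpow_add hx0,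
      ← mul_assoc]
    gcongr
    exact hg.le_far x hx1

lemma IsRegularFilter.memLp {ghat : ℝ → ℝ} {C d e : ℝ} (hg : IsRegularFilter ghat C d e) :
    MemLp ghat 2 volume := by
  simpa using hg.memLp_rpow_mul le_rfl (by linarith [hg.neg_half_lt])

variable {Ω : Type*} [MeasurableSpace Ω] {P : Measure Ω} {B : Set ℝ → Ω → ℂ}

/-- The mean square limit is given, so the isometry already yields an `L²` limit of the integrands.
Only its identification is left, and almost everywhere convergence along a subsequence does that
without any `L²` bound on `g`. -/
lemma PairMem.of_hasL2Sum {hB : IsBrownianMeasure P B} {f : ℤ → ℝ → ℂ} {a : ℤ → Ω → ℂ}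
    {g : ℝ → ℂ} {Y : Ω → ℂ} (hf : ∀ m, PairMem (stochGraph hB) (f m) (a m)) (hY : HasL2Sum P a Y)
    (hlim : ∀ ns : ℕ → ℕ, StrictMono ns → ∃ ms : ℕ → ℕ, StrictMono ms ∧ ∀ᵐ x : ℝ,
      Tendsto (fun l => ∑ m ∈ Finset.Icc (-(ns (ms l) : ℤ)) (ns (ms l)), f m x) atTop
        (𝓝 (g x))) : PairMem (stochGraph hB) g Y := by
  have hsum (M : ℕ) : PairMem (stochGraph hB)
      (fun x => ∑ m ∈ Finset.Icc (-(M : ℤ)) M, f m x)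
      (fun ω => ∑ m ∈ Finset.Icc (-(M : ℤ)) M, a m ω) := PairMem.sum _ fun m _ => hf m
  obtain ⟨F, hF, hFlim⟩ := PairMem.exists_limit hsum hY.1 hY.2
  have hmeas := tendstoInMeasure_of_tendsto_eLpNorm (p := 2) (by simp)
    (fun M => (hsum M).choose.1) hF.choose.1 hFlim
  obtain ⟨ns, hns, hae⟩ := hmeas.exists_seq_tendsto_ae
  obtain ⟨ms, hms, hae'⟩ := hlim ns hns
  refine hF.congr ?_ EventuallyEq.rfl
  filter_upwards [hae, hae'] with x h1 h2
  exact tendsto_nhds_unique (h1.comp hms.tendsto_atTop) h2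

/-- The spectral integrand of `V_{j,k}`. -/
def levelIntegrand (ghat uhat : ℝ → ℝ) (j : ℕ) (k : ℤ) (x : ℝ) : ℂ :=
  ((1 / √(2 * Real.pi) * (2 : ℝ) ^ (-(j : ℝ) / 2) : ℝ) : ℂ) *
    (Complex.exp (Complex.I * k * ((x / 2 ^ j : ℝ) : ℂ)) *
      (scalingHat uhat (x / 2 ^ j) * truncatedFilter ghat j (x / 2 ^ j)))

variable {ghat uhat : ℝ → ℝ} {C d e : ℝ} {ξ : ℤ → Ω → ℝ} {ε : ℕ → ℤ → Ω → ℝ} {Vd : ℕ → ℤ → Ω → ℝ}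

lemma memLp_truncatedFilter_zero (hg : IsRegularFilter ghat C d e) :
    MemLp (fun x => (truncatedFilter ghat 0 x : ℂ)) 2
      (volume.restrict (Set.Ioc (-Real.pi) Real.pi)) := by
  have h1 : MemLp (fun x => ((√(2 * Real.pi) * ghat x : ℝ) : ℂ)) 2
      (volume.restrict (Set.Ioc (-Real.pi) Real.pi)) :=
    ((hg.memLp.const_mul _).ofReal).restrict _
  refine (memLp_congr_ae ?_).1 h1
  rw [EventuallyEq, ae_restrict_iff' measurableSet_Ioc]
  have h0 : ∀ᵐ x : ℝ, x ≠ Real.pi := (Set.countable_singleton Real.pi).ae_notMem volume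
  filter_upwards [h0] with x hx hmem
  rw [truncatedFilter_eq, redMod_of_mem hmem.1.le (lt_of_le_of_ne hmem.2 hx), pow_zero, one_mul]

lemma pairMem_level_zero (hB : IsBrownianMeasure P B) (hg : IsRegularFilter ghat C d e)
    (hD : IsDiscretization P B ghat uhat ξ ε Vd) (k : ℤ) :
    PairMem (stochGraph hB) (levelIntegrand ghat uhat 0 k) (fun ω => (Vd 0 k ω : ℂ)) := by
  refine PairMem.of_hasL2Sum
    (fun n => ((hD.scaling_noise (k - n)).pairMem hB).const_mul _) (hD.initial k)
    fun ns hns => ?_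
  have hper : Function.Periodic (fun x => (truncatedFilter ghat 0 x : ℂ)) (2 * Real.pi) :=
    fun x => by simp only [truncatedFilter_periodic ghat 0 x]
  obtain ⟨ms, hms, hae⟩ := exists_seq_tendsto_fourierSum hper (memLp_truncatedFilter_zero hg)
    (c := fun n => timeFilter (fun x => (truncatedFilter ghat 0 x : ℂ)) (-n))
    (fun n => by
      unfold timeFilter
      congr 1
      refine intervalIntegral.integral_congr fun x _ => ?_
      simp only [Int.cast_neg]
      congr 2
      ring) hns
  refine ⟨ms, hms, ?_⟩
  filter_upwards [hae] with x hx
  have hlim := hx.const_mul (((1 / √(2 * Real.pi) : ℝ) : ℂ) * Complex.exp (Complex.I * k * x)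
      * scalingHat uhat x)
  have heq : ((1 / √(2 * Real.pi) : ℝ) : ℂ) * Complex.exp (Complex.I * k * x)
      * scalingHat uhat x * (truncatedFilter ghat 0 x : ℂ) = levelIntegrand ghat uhat 0 k x := by
    unfold levelIntegrand
    simp only [pow_zero, div_one, Nat.cast_zero, neg_zero, zero_div, Real.rpow_zero, mul_one]
    ring
  rw [heq] at hlim
  refine hlim.congr fun l => ?_
  rw [Finset.mul_sum]
  -- The shift `k - n` in the convolution produces `e^{-inx}`; the symmetric range permits the
  -- change of sign.
  refine Finset.sum_equiv (Equiv.neg ℤ) (fun n => ?_) fun n _ => ?_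
  · simp only [Finset.mem_Icc, Equiv.neg_apply]
    omega
  · simp only [Equiv.neg_apply]
    have : Complex.exp (Complex.I * ((k - -n : ℤ) : ℂ) * x)
        = Complex.exp (Complex.I * k * x) * Complex.exp (Complex.I * n * x) := by
      rw [← Complex.exp_add]
      congr 1
      push_cast
      ring
    rw [this]
    ring

lemma ae_comp_div_two_pow {p : ℝ → Prop} (h : ∀ᵐ x, p x) (j : ℕ) : ∀ᵐ x : ℝ, p (x / 2 ^ j) := by
  have hne : ((2 : ℝ) ^ j)⁻¹ ≠ 0 := by positivity
  have := (Measure.quasiMeasurePreserving_smul (volume : Measure ℝ) hne).ae h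
  filter_upwards [this] with x hx
  rwa [smul_eq_mul, mul_comm, ← div_eq_mul_inv] at hx

lemma pairMem_level_succ (hB : IsBrownianMeasure P B) (hg : IsRegularFilter ghat C d e)
    (hu : IsMeyerFilter uhat) (hD : IsDiscretization P B ghat uhat ξ ε Vd) (j : ℕ)
    (ih : ∀ k : ℤ,
      PairMem (stochGraph hB) (levelIntegrand ghat uhat j k) (fun ω => (Vd j k ω : ℂ)))
    (k : ℤ) :
    PairMem (stochGraph hB) (levelIntegrand ghat uhat (j + 1) k)
      (fun ω => (Vd (j + 1) k ω : ℂ)) := by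
  refine PairMem.of_hasL2Sum (fun n => ((ih n).const_mul _).add
    (((hD.wavelet_noise j n).pairMem hB).const_mul _)) (hD.step j k) fun ns hns => ?_
  obtain ⟨K₁, hK₁⟩ := exists_norm_lowFilter_le hg hu j
  obtain ⟨K₂, hK₂⟩ := exists_norm_highFilter_le hg hu j
  obtain ⟨ms₁, hms₁, hae₁⟩ := exists_seq_tendsto_downsample (lowFilter_periodic hu j)
    (measurable_lowFilter hg hu j) hK₁ k hns
  -- The second subsequence is extracted from the first, so both series converge along it.
  obtain ⟨ms₂, hms₂, hae₂⟩ := exists_seq_tendsto_downsample (highFilter_periodic hu j)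
    (measurable_highFilter hg hu j) hK₂ k (hns.comp hms₁)
  refine ⟨ms₁ ∘ ms₂, hms₁.comp hms₂, ?_⟩
  filter_upwards [ae_comp_div_two_pow hae₁ j, ae_comp_div_two_pow hae₂ j,
    ae_comp_div_two_pow (truncatedFilter_ne_zero_ae hg j) j] with x h₁ h₂ h₃
  set y := x / 2 ^ j with hy
  set A : ℂ := ((1 / √(2 * Real.pi) * (2 : ℝ) ^ (-(j : ℝ) / 2) : ℝ) : ℂ) with hA
  have hlim := (((h₁.comp hms₂.tendsto_atTop).mul_const
    (scalingHat uhat y * truncatedFilter ghat j y : ℂ)).add (h₂.mul_const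
    ((starRingEnd ℂ) (waveletHat uhat y)))).const_mul A
  rw [downsample_reconstruction hu j k h₃] at hlim
  have heq : A * (Complex.exp (Complex.I * k * ((y / 2 : ℝ) : ℂ)) *
      (scalingHat uhat (y / 2) * truncatedFilter ghat (j + 1) (y / 2)) / √2)
      = levelIntegrand ghat uhat (j + 1) k x := by
    have hx2 : x / 2 ^ (j + 1) = y / 2 := by
      rw [hy, pow_succ]
      field_simp
    have hA2 : ((1 / √(2 * Real.pi) * (2 : ℝ) ^ (-((j + 1 : ℕ) : ℝ) / 2) : ℝ) : ℂ)
        = A / (√2 : ℝ) := by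
      rw [hA, ← Complex.ofReal_div]
      congr 1
      rw [mul_div_assoc]
      congr 1
      rw [Real.sqrt_eq_rpow, ← Real.rpow_sub two_pos]
      congr 1
      push_cast
      ring
    unfold levelIntegrand
    rw [hx2, hA2]
    ring
  rw [heq] at hlim
  refine hlim.congr fun l => ?_
  simp only [Function.comp_apply]
  rw [Finset.sum_mul, Finset.sum_mul, ← Finset.sum_add_distrib, Finset.mul_sum]
  refine Finset.sum_congr rfl fun n _ => ?_
  simp only [levelIntegrand, ← hy, ← hA]
  ring

/-- `V_{j,k}` is the stochastic integral of `levelIntegrand`. -/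
theorem IsDiscretization.pairMem (hB : IsBrownianMeasure P B) (hg : IsRegularFilter ghat C d e)
    (hu : IsMeyerFilter uhat) (hD : IsDiscretization P B ghat uhat ξ ε Vd) (j : ℕ) (k : ℤ) :
    PairMem (stochGraph hB) (levelIntegrand ghat uhat j k) (fun ω => (Vd j k ω : ℂ)) := by
  induction j generalizing k with
  | zero => exact pairMem_level_zero hB hg hD k
  | succ j ih => exact pairMem_level_succ hB hg hu hD j ih k

end Representation

/-! ### Mean square estimates -/

section Estimates

/-- Interpolation between the bounds `|a|` and `2` for `|e^{ia} - 1|`, with `a = (t - s)x`. -/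
lemma norm_exp_sub_exp_le {h : ℝ} (h0 : 0 ≤ h) (h1 : h ≤ 1) (t s x : ℝ) :
    ‖Complex.exp (Complex.I * t * x) - Complex.exp (Complex.I * s * x)‖
      ≤ 2 * |t - s| ^ h * |x| ^ h := by
  have hfac : Complex.exp (Complex.I * t * x) - Complex.exp (Complex.I * s * x)
      = Complex.exp (((s * x : ℝ) : ℂ) * Complex.I)
        * (Complex.exp (Complex.I * (((t - s) * x : ℝ) : ℂ)) - 1) := by
    rw [mul_sub, mul_one, ← Complex.exp_add]
    congr 2 <;> push_cast <;> ring
  rw [hfac, norm_mul, Complex.norm_exp_ofReal_mul_I, one_mul, mul_assoc,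
    ← Real.mul_rpow (abs_nonneg _) (abs_nonneg _), ← abs_mul]
  set a := (t - s) * x
  rcases le_total |a| 1 with ha | ha
  · have h2 : ‖Complex.exp (Complex.I * (a : ℂ)) - 1‖ ≤ |a| :=
      Real.norm_exp_I_mul_ofReal_sub_one_le
    have h3 : |a| ≤ |a| ^ h := Real.self_le_rpow_of_le_one (abs_nonneg _) ha h1
    linarith [abs_nonneg a]
  · have h2 : ‖Complex.exp (Complex.I * (a : ℂ)) - 1‖ ≤ 2 := by
      refine (norm_sub_le _ _).trans ?_
      rw [mul_comm, Complex.norm_exp_ofReal_mul_I, norm_one]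
      norm_num
    have h3 : 1 ≤ |a| ^ h := Real.one_le_rpow ha h0
    linarith

lemma eLpNorm_le_ofReal_mul {α E F : Type*} [MeasurableSpace α] [NormedAddCommGroup E]
    [NormedAddCommGroup F] {μ : Measure α} {f : α → E} {w : α → F} {c : ℝ}
    (h : ∀ x, ‖f x‖ ≤ c * ‖w x‖) : eLpNorm f 2 μ ≤ ENNReal.ofReal c * eLpNorm w 2 μ :=
  eLpNorm_le_mul_eLpNorm_of_ae_le_mul (ae_of_all _ h) 2

variable {ghat uhat : ℝ → ℝ} {C d e : ℝ}

/-- The tail of the envelope of a regular filter. -/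
def tailEnvelope (C d h x : ℝ) : ℝ := if 1 ≤ |x| then 5 * C * |x| ^ (h - 1 - d) else 0

lemma memLp_tailEnvelope {h : ℝ} (hC : 0 < C) (hd : h < d + 1 / 2) :
    MemLp (tailEnvelope C d h) 2 volume := by
  refine memLp_two_of_power_bounds (a := 0) (b := h - 1 - d) (C := 5 * C) (by norm_num)
    (by linarith) ?_ (fun x _ hx1 => ?_) fun x hx => ?_
  · refine (Measurable.ite (measurableSet_le measurable_const (by fun_prop)) ?_
      measurable_const).aestronglyMeasurable
    fun_prop
  · rw [Real.rpow_zero, mul_one]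
    unfold tailEnvelope
    split_ifs with h1
    · rw [le_antisymm hx1 h1, Real.one_rpow, mul_one, abs_of_pos (by positivity)]
    · simpa using hC.le
  · unfold tailEnvelope
    rw [if_pos hx, abs_of_nonneg (by positivity)]

lemma abs_redMod_ge {y : ℝ} (h1 : 2 * Real.pi / 3 ≤ |y|) (h2 : |y| ≤ 4 * Real.pi / 3) :
    2 * Real.pi / 3 ≤ |redMod y| := by
  have hpi := Real.pi_pos
  obtain ⟨n, hn⟩ := exists_redMod_eq y
  by_cases hn0 : n = 0
  · rw [hn, hn0]
    simpa using h1
  · have hn1 : (1 : ℝ) ≤ |(n : ℝ)| := by exact_mod_cast Int.one_le_abs hn0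
    have h3 : |(n : ℝ) * (2 * Real.pi)| ≤ |y| + |redMod y| := by
      rw [show (n : ℝ) * (2 * Real.pi) = y - redMod y by linarith]
      exact abs_sub _ _
    rw [abs_mul, abs_of_pos (show 0 < 2 * Real.pi by linarith)] at h3
    nlinarith

/-- The two filters agree for `|y| ≤ 2π/3`. Outside, the aliased one costs `4C` and the true one `C`
times `|x|^{-1-d}`, whence the `5` in the envelope. -/
lemma abs_aliased_sub_le (hg : IsRegularFilter ghat C d e) (hu : IsMeyerFilter uhat) {h : ℝ}
    (h0 : 0 ≤ h) (J : ℕ) (y : ℝ) :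
    |scalingHat uhat y * ghat (2 ^ J * redMod y) - ghat (2 ^ J * y)|
      ≤ ((2 : ℝ) ^ J) ^ (-h) * |tailEnvelope C d h (2 ^ J * y)| := by
  have hpi := Real.pi_gt_three
  have hC := hg.const_pos
  have h2J : (1 : ℝ) ≤ 2 ^ J := one_le_pow₀ one_le_two
  have h2p : (0 : ℝ) < 2 ^ J := by positivity
  by_cases hy : |y| ≤ 2 * Real.pi / 3
  · have := abs_le.1 hy
    rw [hu.scalingHat_eq_one hy, redMod_of_mem (by linarith) (by linarith), one_mul, sub_self,
      abs_zero]
    positivity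
  push Not at hy
  set x := 2 ^ J * y with hx
  have hxabs : |x| = 2 ^ J * |y| := by rw [hx, abs_mul, abs_of_pos h2p]
  have hx1 : 2 ^ J ≤ |x| := by
    rw [hxabs]
    nlinarith
  have hx0 : 0 < |x| := by linarith
  have hexp : -1 - d < 0 := by linarith [hg.neg_half_lt]
  have hfar : |ghat x| ≤ C * |x| ^ (-1 - d) := by
    rw [abs_of_pos (hg.pos x (abs_pos.1 hx0))]
    exact hg.le_far x (by linarith)
  -- On the support of `φ̂`, reduction at most halves the modulus; this costs `2^{1+d} ≤ 4`.
  have halias : |scalingHat uhat y * ghat (2 ^ J * redMod y)| ≤ 4 * C * |x| ^ (-1 - d) := by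
    by_cases hy2 : |y| ≤ 4 * Real.pi / 3
    · have hr := abs_redMod_ge hy.le hy2
      have hzabs : |2 ^ J * redMod y| = 2 ^ J * |redMod y| := by rw [abs_mul, abs_of_pos h2p]
      have hz1 : 1 ≤ |2 ^ J * redMod y| := by
        rw [hzabs]
        nlinarith
      have hz2 : |x| / 2 ≤ |2 ^ J * redMod y| := by
        rw [hzabs, hxabs]
        nlinarith
      calc |scalingHat uhat y * ghat (2 ^ J * redMod y)|
          ≤ 1 * |ghat (2 ^ J * redMod y)| := by
            rw [abs_mul]
            gcongr
            exact hu.abs_scalingHat_le y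
        _ ≤ C * |2 ^ J * redMod y| ^ (-1 - d) := by
            rw [one_mul, abs_of_pos (hg.pos _ (abs_pos.1 (by linarith)))]
            exact hg.le_far _ hz1
        _ ≤ C * (|x| / 2) ^ (-1 - d) := by
            gcongr C * ?_
            exact Real.rpow_le_rpow_of_nonpos (by linarith) hz2 hexp.le
        _ = C * (2 ^ (1 + d) * |x| ^ (-1 - d)) := by
            rw [Real.div_rpow hx0.le (by norm_num), div_eq_inv_mul, ← Real.rpow_neg (by norm_num)]
            congr 3
            ring
        _ ≤ C * (2 ^ (2 : ℝ) * |x| ^ (-1 - d)) := by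
            gcongr
            · norm_num
            · linarith [hg.lt_half]
        _ = 4 * C * |x| ^ (-1 - d) := by
            norm_num
            ring
    · rw [scalingHat, if_neg hy2, zero_mul, abs_zero]
      positivity
  have htail : |tailEnvelope C d h x| = 5 * C * (|x| ^ h * |x| ^ (-1 - d)) := by
    rw [tailEnvelope, if_pos (by linarith), abs_of_nonneg (by positivity), ← Real.rpow_add hx0]
    congr 2
    ring
  -- Since `|x| ≥ 2^J` here, inserting `(|x|/2^J)^h` trades decay in `x` for the rate in `J`.
  have hone : 1 ≤ ((2 : ℝ) ^ J) ^ (-h) * |x| ^ h := by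
    rw [Real.rpow_neg h2p.le, ← div_eq_inv_mul, ← Real.div_rpow hx0.le h2p.le]
    exact Real.one_le_rpow ((one_le_div h2p).2 hx1) h0
  rw [htail]
  calc |scalingHat uhat y * ghat (2 ^ J * redMod y) - ghat x|
      ≤ 4 * C * |x| ^ (-1 - d) + C * |x| ^ (-1 - d) :=
        (abs_sub _ _).trans (add_le_add halias hfar)
    _ = 1 * (5 * C * |x| ^ (-1 - d)) := by ring
    _ ≤ (((2 : ℝ) ^ J) ^ (-h) * |x| ^ h) * (5 * C * |x| ^ (-1 - d)) := by gcongr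
    _ = _ := by ring

variable {Ω : Type*} [MeasurableSpace Ω] {P : Measure Ω} {B : Set ℝ → Ω → ℂ}
  {ξ : ℤ → Ω → ℝ} {ε : ℕ → ℤ → Ω → ℝ} {Vd : ℕ → ℤ → Ω → ℝ} {V : ℝ → Ω → ℝ}

lemma norm_exp_velocity (t x : ℝ) : ‖Complex.exp (Complex.I * t * x)‖ = 1 := by
  rw [show Complex.I * t * x = ((t * x : ℝ) : ℂ) * Complex.I by push_cast; ring,
    Complex.norm_exp_ofReal_mul_I]

/-- Moments of the increment reduce to the `L²` norm of its integrand, bounded by `2|t - s|^h |x|^h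
ĝ(x)`. -/
lemma exists_eLpNorm_increment_le (hB : IsBrownianMeasure P B) (hg : IsRegularFilter ghat C d e)
    (hV : IsVelocityProcess P B ghat V) {h : ℝ} (h0 : 0 ≤ h) (h1 : h ≤ 1) (hd : h < d + 1 / 2)
    {p : ENNReal} (hp1 : 1 ≤ p) (hp : p ≠ ⊤) :
    ∃ K : ENNReal, K ≠ ⊤ ∧ ∀ s t, 0 ≤ s → 0 ≤ t →
      eLpNorm (fun ω => V t ω - V s ω) p P ≤ K * ENNReal.ofReal (|t - s| ^ h) := by
  obtain ⟨K, hK, hle⟩ := exists_eLpNorm_le_eLpNorm_two hB hp1 hp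
  have hw := hg.memLp_rpow_mul h0 hd
  refine ⟨K * (ENNReal.ofReal 2 * eLpNorm (fun x => |x| ^ h * ghat x) 2 volume),
    ENNReal.mul_ne_top hK (ENNReal.mul_ne_top ENNReal.ofReal_ne_top hw.2.ne),
    fun s t hs ht => ?_⟩
  have hpair := ((hV t ht).pairMem hB).sub ((hV s hs).pairMem hB)
  have hnorm : eLpNorm (fun ω => V t ω - V s ω) p P
      = eLpNorm (fun ω => (V t ω : ℂ) - (V s ω : ℂ)) p P :=
    eLpNorm_congr_norm_ae (ae_of_all _ fun ω => by
      rw [← Complex.ofReal_sub, Complex.norm_real])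
  rw [hnorm]
  refine (hle _ _ hpair).trans ?_
  rw [mul_assoc, mul_assoc, mul_comm (eLpNorm _ 2 volume), ← mul_assoc (ENNReal.ofReal 2),
    ← ENNReal.ofReal_mul zero_le_two]
  gcongr
  refine eLpNorm_le_ofReal_mul fun x => ?_
  rw [← sub_mul, norm_mul, Complex.norm_real, norm_mul,
    Real.norm_of_nonneg (show 0 ≤ |x| ^ h by positivity), ← mul_assoc]
  gcongr
  exact norm_exp_sub_exp_le h0 h1 t s x

/-- After the normalizations cancel, the two integrands share the phase `e^{ik2^{-J}x}`, so only the
aliasing error remains, uniformly in `k`. -/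
lemma exists_eLpNorm_discretization_le (hB : IsBrownianMeasure P B)
    (hg : IsRegularFilter ghat C d e) (hu : IsMeyerFilter uhat)
    (hV : IsVelocityProcess P B ghat V) (hD : IsDiscretization P B ghat uhat ξ ε Vd)
    {h : ℝ} (h0 : 0 ≤ h) (hd : h < d + 1 / 2) :
    ∃ K : ENNReal, K ≠ ⊤ ∧ ∀ J k : ℕ,
      eLpNorm (fun ω => V ((k : ℝ) / 2 ^ J) ω - (2 : ℝ) ^ ((J : ℝ) / 2) * Vd J (k : ℤ) ω) 2 P
        ≤ K * ENNReal.ofReal (((2 : ℝ) ^ J) ^ (-h)) := by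
  have hw := memLp_tailEnvelope (C := C) (d := d) hg.const_pos hd
  refine ⟨eLpNorm (tailEnvelope C d h) 2 volume, hw.2.ne, fun J k => ?_⟩
  have hpair := ((hV ((k : ℝ) / 2 ^ J) (by positivity)).pairMem hB).sub
    ((hD.pairMem hB hg hu J k).const_mul (((2 : ℝ) ^ ((J : ℝ) / 2) : ℝ) : ℂ))
  have hnorm : eLpNorm
      (fun ω => V ((k : ℝ) / 2 ^ J) ω - (2 : ℝ) ^ ((J : ℝ) / 2) * Vd J (k : ℤ) ω) 2 P
      = eLpNorm (fun ω => (V ((k : ℝ) / 2 ^ J) ω : ℂ)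
          - (((2 : ℝ) ^ ((J : ℝ) / 2) : ℝ) : ℂ) * (Vd J (k : ℤ) ω : ℂ)) 2 P :=
    eLpNorm_congr_norm_ae (ae_of_all _ fun ω => by
      rw [← Complex.ofReal_mul, ← Complex.ofReal_sub, Complex.norm_real])
  rw [hnorm, hpair.eLpNorm_eq, mul_comm (eLpNorm (tailEnvelope C d h) 2 volume)]
  refine eLpNorm_le_ofReal_mul fun x => ?_
  set y := x / 2 ^ J with hy
  have hxy : x = 2 ^ J * y := by
    rw [hy]
    field_simp
  have hA : (2 : ℝ) ^ ((J : ℝ) / 2) * (1 / √(2 * Real.pi) * (2 : ℝ) ^ (-(J : ℝ) / 2))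
      * √(2 * Real.pi) = 1 := by
    have h2 : (2 : ℝ) ^ ((J : ℝ) / 2) * (2 : ℝ) ^ (-(J : ℝ) / 2) = 1 := by
      rw [← Real.rpow_add two_pos]
      ring_nf
      simp
    have hs : √(2 * Real.pi) ≠ 0 := by
      have := Real.pi_pos
      positivity
    rw [mul_assoc, mul_right_comm, one_div_mul_cancel hs, one_mul, h2]
  have hexp : Complex.exp (Complex.I * (k : ℤ) * (y : ℂ))
      = Complex.exp (Complex.I * (((k : ℝ) / 2 ^ J : ℝ) : ℂ) * x) := by
    congr 1
    rw [hxy]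
    push_cast
    field_simp
  have heq : Complex.exp (Complex.I * (((k : ℝ) / 2 ^ J : ℝ) : ℂ) * x) * (ghat x : ℂ)
      - (((2 : ℝ) ^ ((J : ℝ) / 2) : ℝ) : ℂ) * levelIntegrand ghat uhat J k x
      = -(Complex.exp (Complex.I * (((k : ℝ) / 2 ^ J : ℝ) : ℂ) * x) *
        ((scalingHat uhat y * ghat (2 ^ J * redMod y) - ghat (2 ^ J * y) : ℝ) : ℂ)) := by
    have hA' : (((2 : ℝ) ^ ((J : ℝ) / 2) : ℝ) : ℂ) *
        ((1 / √(2 * Real.pi) * (2 : ℝ) ^ (-(J : ℝ) / 2) : ℝ) : ℂ) * (√(2 * Real.pi) : ℝ) = 1 := by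
      exact_mod_cast hA
    rw [levelIntegrand, ← hy, hexp, truncatedFilter_eq, ← hxy]
    simp only [Complex.ofReal_sub, Complex.ofReal_mul] at hA' ⊢
    linear_combination (-Complex.exp (Complex.I * (((k : ℝ) / 2 ^ J : ℝ) : ℂ) * x) *
      scalingHat uhat y * ghat (2 ^ J * redMod y)) * hA'
  have hb := abs_aliased_sub_le hg hu h0 J y
  rw [heq, norm_neg, norm_mul, norm_exp_velocity, one_mul, Complex.norm_real, Real.norm_eq_abs,
    Real.norm_eq_abs]
  rwa [← hxy] at hb ⊢

/-- A velocity process has a modification with continuous paths. -/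
lemma IsVelocityProcess.exists_continuous_modification (hB : IsBrownianMeasure P B)
    (hg : IsRegularFilter ghat C d e) (hV : IsVelocityProcess P B ghat V) :
    ∃ W : ℝ → Ω → ℝ, (∀ t, Measurable (W t)) ∧ (∀ ω, Continuous fun t => W t ω) ∧
      ∀ t, 0 ≤ t → W t =ᵐ[P] V t := by
  have hd1 := hg.neg_half_lt
  have hd2 := hg.lt_half
  set h := (d + 1 / 2) / 2 with hh
  have hh0 : 0 < h := by linarith
  -- This exponent turns the Hölder factor `|t - s|^h` into `|t - s|^2` in the `p`-th moment.
  set p := 2 / h with hp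
  have hp0 : 0 < p := by positivity
  have hp1 : 1 ≤ p := by
    rw [hp, le_div_iff₀ hh0]
    linarith
  obtain ⟨K, hK, hinc⟩ := exists_eLpNorm_increment_le (p := ENNReal.ofReal p) hB hg hV
    hh0.le (by linarith) (by linarith) (by rwa [ENNReal.one_le_ofReal]) ENNReal.ofReal_ne_top
  have hmeas (t : ℝ) (ht : 0 ≤ t) : AEMeasurable (V t) P := by
    have h1 := (hV t ht).2.1.1.aemeasurable
    exact Complex.measurable_re.comp_aemeasurable h1
  refine AnomalousDiffusion.exists_continuous_modification (K := K ^ p) hmeas hp0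
    (ENNReal.rpow_ne_top_of_nonneg hp0.le hK) fun s t hs ht => ?_
  have h1 := hinc s t hs ht
  rw [eLpNorm_eq_lintegral_rpow_enorm_toReal (by simpa using hp0) ENNReal.ofReal_ne_top,
    ENNReal.toReal_ofReal hp0.le, one_div, ENNReal.rpow_inv_le_iff hp0,
    ENNReal.mul_rpow_of_nonneg _ _ hp0.le, ENNReal.ofReal_rpow_of_nonneg (by positivity) hp0.le,
    ← Real.rpow_mul (abs_nonneg _), hp, mul_div_cancel₀ _ hh0.ne', ← hp] at h1
  exact_mod_cast h1

end Estimates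

/-! ### The spectral filters of the fOU and fGLE velocity processes -/

section VelocityFilters

lemma gamma_mul_sin_pos {d : ℝ} (h1 : -(1 / 2) < d) (h2 : d < 1 / 2) :
    0 < Real.Gamma (2 * d + 2) * Real.sin (Real.pi * (d + 1 / 2)) := by
  have hpi := Real.pi_pos
  refine mul_pos (Real.Gamma_pos_of_pos (by linarith)) (Real.sin_pos_of_pos_of_lt_pi ?_ ?_)
  · exact mul_pos hpi (by linarith)
  · nlinarith

lemma continuousOn_abs_rpow (r : ℝ) : ContinuousOn (fun x : ℝ => |x| ^ r) {0}ᶜ :=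
  continuous_abs.continuousOn.rpow_const fun _ hx => Or.inl (abs_ne_zero.2 hx)

lemma isRegularFilter_fou {σ ζ d : ℝ} (hσ : 0 < σ) (hζ : 0 < ζ) (h1 : -(1 / 2) < d)
    (h2 : d < 1 / 2) : ∃ C, IsRegularFilter (fouFilter σ ζ d) C d d := by
  have hG := gamma_mul_sin_pos h1 h2
  set c := σ * √(Real.Gamma (2 * d + 2) * Real.sin (Real.pi * (d + 1 / 2))) with hc
  have hc0 : 0 < c := by positivity
  have hform (x : ℝ) : fouFilter σ ζ d x = c * (1 / √(ζ ^ 2 + x ^ 2)) * |x| ^ (-d) := rfl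
  have hmax : 0 < max (c / ζ) c := lt_max_of_lt_right hc0
  refine ⟨max (c / ζ) c, h1, h2, h2, fun x hx => ?_, ?_, fun x hx hx1 => ?_, fun x hx => ?_⟩
  · have := abs_pos.2 hx
    rw [hform]
    positivity
  · refine ContinuousOn.mul (Continuous.continuousOn ?_) (continuousOn_abs_rpow (-d))
    refine continuous_const.mul (continuous_const.div (by fun_prop) fun x => ?_)
    positivity
  · rw [hform]
    gcongr
    refine le_trans ?_ (le_max_left _ _)
    rw [mul_one_div]
    gcongr
    exact Real.le_sqrt_of_sq_le (by nlinarith [sq_nonneg x])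
  · have hx0 : 0 < |x| := by linarith
    rw [hform, show -1 - d = -1 + -d by ring, Real.rpow_add hx0, ← mul_assoc, Real.rpow_neg_one]
    gcongr
    · exact le_max_right _ _
    · rw [one_div]
      gcongr
      exact Real.abs_le_sqrt (by nlinarith [sq_nonneg ζ])

/-- The sign of `b` is no obstacle: the denominator is the square root of `a² + (b + m r)²` with `r
= |x|^{1+2d}` and `a > 0`. It is bounded below by a constant and by a multiple of `r`, giving
`|x|^d` at the origin and `|x|^{-1-d}` at infinity. -/
lemma isRegularFilter_fgle {m ζ kB τ d : ℝ} (hm : 0 < m) (hζ : 0 < ζ) (hk : 0 < kB) (hτ : 0 < τ)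
    (h1 : 0 < d) (h2 : d < 1 / 2) : ∃ C, IsRegularFilter (fgleFilter m ζ kB τ d) C d (-d) := by
  have hG := gamma_mul_sin_pos (by linarith) h2
  set a := ζ * Real.Gamma (2 * d + 2) * Real.sin (Real.pi * (d + 1 / 2)) with ha
  set b := ζ * Real.Gamma (2 * d + 2) * Real.cos (Real.pi * (d + 1 / 2)) with hb
  set c := √(2 * ζ * kB * τ * Real.Gamma (2 * d + 2) * Real.sin (Real.pi * (d + 1 / 2))) with hc
  have ha0 : 0 < a := by
    rw [ha, mul_assoc]
    positivity
  have hc0 : 0 < c := by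
    rw [hc, mul_assoc]
    positivity
  have hquad : ∃ κ : ℝ, 0 < κ ∧ ∀ r : ℝ,
      κ ^ 2 ≤ a ^ 2 + (b + m * r) ^ 2 ∧ (κ * r) ^ 2 ≤ a ^ 2 + (b + m * r) ^ 2 := by
    set D := a + |b| + m with hD
    have hb0 := abs_nonneg b
    have hD0 : 0 < D := by positivity
    have haD : a ^ 2 ≤ D ^ 2 := pow_le_pow_left₀ ha0.le (by linarith) 2
    have hbD : b ^ 2 ≤ D ^ 2 := sq_abs b ▸ pow_le_pow_left₀ hb0 (by linarith) 2
    refine ⟨a * m / (2 * D), by positivity, fun r => ⟨?_, ?_⟩⟩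
    · have h3 : a * m / (2 * D) ≤ a := by
        rw [div_le_iff₀ (by positivity)]
        nlinarith
      nlinarith [pow_le_pow_left₀ (by positivity) h3 2, sq_nonneg (b + m * r)]
    · set q := b + m * r with hq
      have h3 : a * m / (2 * D) * r = a * (q - b) / (2 * D) := by
        rw [hq]
        ring
      rw [h3, div_pow, div_le_iff₀ (by positivity)]
      have h4 : a ^ 2 * q ^ 2 ≤ D ^ 2 * q ^ 2 := mul_le_mul_of_nonneg_right haD (sq_nonneg _)
      have h5 : a ^ 2 * b ^ 2 ≤ a ^ 2 * D ^ 2 := mul_le_mul_of_nonneg_left hbD (sq_nonneg _)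
      nlinarith [sq_nonneg (a * (q + b)), mul_nonneg (sq_nonneg D) (sq_nonneg q),
        mul_nonneg (sq_nonneg a) (sq_nonneg D)]
  obtain ⟨κ, hκ, hκle⟩ := hquad
  have hform (x : ℝ) : fgleFilter m ζ kB τ d x
      = c * (1 / √(a ^ 2 + (b + m * |x| ^ (1 + 2 * d)) ^ 2)) * |x| ^ d := by
    have h3 : |x| ^ (2 * (1 + 2 * d)) = (|x| ^ (1 + 2 * d)) ^ 2 := by
      rw [mul_comm, Real.rpow_mul (abs_nonneg _)]
      norm_num
    simp only [fgleFilter, ← ha, ← hb, ← hc]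
    rw [h3]
    congr 4
    ring
  have hden (r : ℝ) : 0 < a ^ 2 + (b + m * r) ^ 2 := by positivity
  refine ⟨c / κ, by linarith, h2, by linarith, fun x hx => ?_, ?_, fun x hx hx1 => ?_,
    fun x hx => ?_⟩
  · have := abs_pos.2 hx
    have := hden (|x| ^ (1 + 2 * d))
    rw [hform]
    positivity
  · have : fgleFilter m ζ kB τ d
        = fun x => c * (1 / √(a ^ 2 + (b + m * |x| ^ (1 + 2 * d)) ^ 2)) * |x| ^ d := funext hform
    rw [this]
    refine ContinuousOn.mul ?_ (continuousOn_abs_rpow d)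
    refine continuousOn_const.mul (continuousOn_const.div ?_ fun x _ => ?_)
    · exact (continuousOn_const.add ((continuousOn_const.add
        (continuousOn_const.mul (continuousOn_abs_rpow _))).pow 2)).sqrt
    · have := hden (|x| ^ (1 + 2 * d))
      positivity
  · rw [hform, neg_neg, mul_one_div]
    gcongr
    exact Real.le_sqrt_of_sq_le (hκle _).1
  · have hx0 : 0 < |x| := by linarith
    have h3 : |x| ^ (-1 - d) = (|x| ^ (1 + 2 * d))⁻¹ * |x| ^ d := by
      rw [← Real.rpow_neg hx0.le, ← Real.rpow_add hx0]
      congr 1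
      ring
    rw [hform, h3, ← mul_assoc, mul_one_div, ← div_eq_mul_inv, div_div]
    gcongr
    exact Real.le_sqrt_of_sq_le (hκle _).2

lemma IsVelocityFilter.exists_isRegularFilter {ghat : ℝ → ℝ} (hg : IsVelocityFilter ghat) :
    ∃ C d e, IsRegularFilter ghat C d e := by
  rcases hg with ⟨σ, ζ, d, hσ, hζ, h1, h2, rfl⟩ | ⟨m, ζ, kB, τ, d, hm, hζ, hk, hτ, h1, h2, rfl⟩
  · obtain ⟨C, hC⟩ := isRegularFilter_fou hσ hζ h1 h2
    exact ⟨C, d, d, hC⟩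
  · obtain ⟨C, hC⟩ := isRegularFilter_fgle hm hζ hk hτ h1 h2
    exact ⟨C, d, -d, hC⟩

end VelocityFilters

/-! ### Pathwise error of the Riemann sums -/

section Pathwise

lemma tendsto_dyadic {t : ℝ} (ht : 0 ≤ t) : Tendsto (fun n => dyadic n t) atTop (𝓝 t) := by
  rw [tendsto_iff_dist_tendsto_zero]
  refine squeeze_zero (fun _ => dist_nonneg) (fun n => abs_dyadic_sub_le n ht) ?_
  exact tendsto_pow_atTop_nhds_zero_of_lt_one (by norm_num) (by norm_num)

lemma dyadic_le (n : ℕ) {t : ℝ} (ht : 0 ≤ t) : dyadic n t ≤ t := by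
  unfold dyadic
  rw [div_le_iff₀ (by positivity), mul_comm t]
  exact Nat.floor_le (by positivity)

/-- Two processes with continuous paths that are modifications of each other are
indistinguishable. -/
lemma ae_eq_of_continuousOn {Ω : Type*} [MeasurableSpace Ω] {P : Measure Ω} {W W' : ℝ → Ω → ℝ}
    (h : ∀ t, 0 ≤ t → W t =ᵐ[P] W' t)
    (hW : ∀ᵐ ω ∂P, ContinuousOn (fun t => W t ω) (Set.Ici 0))
    (hW' : ∀ ω, Continuous fun t => W' t ω) :
    ∀ᵐ ω ∂P, ∀ t, 0 ≤ t → W t ω = W' t ω := by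
  have hd : ∀ᵐ ω ∂P, ∀ n k : ℕ, W ((k : ℝ) / 2 ^ n) ω = W' ((k : ℝ) / 2 ^ n) ω :=
    ae_all_iff.2 fun n => ae_all_iff.2 fun k => h _ (by positivity)
  filter_upwards [hd, hW] with ω h1 h2 t ht
  have hlim := tendsto_dyadic ht
  have hlim' : Tendsto (fun n => dyadic n t) atTop (𝓝[Set.Ici 0] t) :=
    tendsto_nhdsWithin_iff.2 ⟨hlim, Eventually.of_forall fun n => dyadic_nonneg n t⟩
  have h3 := (h2 t ht).tendsto.comp hlim'
  have h4 := ((hW' ω).tendsto t).comp hlim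
  refine tendsto_nhds_unique (h3.congr fun n => ?_) h4
  exact h1 n _

/-- The maximum of a path over the dyadic points of `[0, R]`. -/
def dyadicMax {Ω : Type*} (W : ℝ → Ω → ℝ) (R : ℝ) (ω : Ω) : ENNReal :=
  ⨆ n : ℕ, ⨆ k : ℕ, if (k : ℝ) / 2 ^ n ≤ R then ‖W ((k : ℝ) / 2 ^ n) ω‖ₑ else 0

lemma measurable_dyadicMax {Ω : Type*} [MeasurableSpace Ω] {W : ℝ → Ω → ℝ}
    (hW : ∀ t, Measurable (W t)) (R : ℝ) : Measurable (dyadicMax W R) := by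
  refine Measurable.iSup fun n => Measurable.iSup fun k => ?_
  split_ifs
  · exact (hW _).enorm
  · exact measurable_const

lemma dyadicMax_lt_top {Ω : Type*} {W : ℝ → Ω → ℝ} {ω : Ω} (hW : Continuous fun t => W t ω)
    (R : ℝ) : dyadicMax W R ω < ⊤ := by
  obtain ⟨K, hK⟩ := (isCompact_Icc (a := (0 : ℝ)) (b := R)).exists_bound_of_continuousOn
    hW.continuousOn
  refine lt_of_le_of_lt (iSup_le fun n => iSup_le fun k => ?_) (ENNReal.ofReal_lt_top (r := K))
  split_ifs with h
  · rw [← ofReal_norm]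
    exact ENNReal.ofReal_le_ofReal (hK _ ⟨by positivity, h⟩)
  · exact zero_le

lemma norm_le_dyadicMax {Ω : Type*} {W : ℝ → Ω → ℝ} {ω : Ω} (hW : Continuous fun t => W t ω)
    {R t : ℝ} (ht : 0 ≤ t) (htR : t ≤ R) : ‖W t ω‖ ≤ (dyadicMax W R ω).toReal := by
  have hlim := ((hW.tendsto t).comp (tendsto_dyadic ht)).norm
  refine le_of_tendsto hlim (Eventually.of_forall fun n => ?_)
  refine (ENNReal.ofReal_le_iff_le_toReal (dyadicMax_lt_top hW R).ne).1 ?_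
  rw [ofReal_norm]
  refine le_trans ?_ (le_iSup_of_le n (le_iSup_of_le ⌊(2 : ℝ) ^ n * t⌋₊ le_rfl))
  exact (if_pos ((dyadic_le n ht).trans htR)).ge

/-- The integrated distance at scale `2^{-J}` between a path and a sequence. -/
def stepError {Ω : Type*} (W : ℝ → Ω → ℝ) (Y : ℕ → Ω → ℝ) (J n : ℕ) (ω : Ω) : ENNReal :=
  ∑ k ∈ Finset.range n,
    ∫⁻ s in Set.Ioc ((k : ℝ) / 2 ^ J) (((k + 1 : ℕ) : ℝ) / 2 ^ J), ‖W s ω - Y k ω‖ₑ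

/-- The bound uses all `m` cells, whichever `n ≤ m` is taken; this is the source of uniformity in
`t`. -/
lemma abs_integral_sub_sum_le {Ω : Type*} {W : ℝ → Ω → ℝ} {ω : Ω}
    (hW : Continuous fun t => W t ω) (Y : ℕ → Ω → ℝ) (J : ℕ) {n m : ℕ} (hnm : n ≤ m)
    (hfin : stepError W Y J m ω ≠ ⊤) :
    |(∫ s in (0 : ℝ)..((n : ℝ) / 2 ^ J), W s ω) - ∑ k ∈ Finset.range n, Y k ω * (1 / 2 ^ J)|
      ≤ (stepError W Y J m ω).toReal := by
  have hint (a b : ℝ) : IntervalIntegrable (fun s => W s ω) volume a b := hW.intervalIntegrable a b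
  have hsum : (∫ s in (0 : ℝ)..((n : ℝ) / 2 ^ J), W s ω)
      = ∑ k ∈ Finset.range n, ∫ s in ((k : ℝ) / 2 ^ J)..(((k + 1 : ℕ) : ℝ) / 2 ^ J), W s ω := by
    rw [intervalIntegral.sum_integral_adjacent_intervals (a := fun k : ℕ => (k : ℝ) / 2 ^ J)
      fun k _ => hint _ _]
    simp
  have hpiece (k : ℕ) : (∫ s in ((k : ℝ) / 2 ^ J)..(((k + 1 : ℕ) : ℝ) / 2 ^ J), W s ω)
      - Y k ω * (1 / 2 ^ J)
      = ∫ s in ((k : ℝ) / 2 ^ J)..(((k + 1 : ℕ) : ℝ) / 2 ^ J), (W s ω - Y k ω) := by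
    rw [intervalIntegral.integral_sub (hint _ _) intervalIntegrable_const,
      intervalIntegral.integral_const, smul_eq_mul]
    push_cast
    ring
  rw [hsum, ← Finset.sum_sub_distrib]
  simp only [hpiece]
  rw [← Real.norm_eq_abs]
  refine (ENNReal.ofReal_le_iff_le_toReal hfin).1 ?_
  rw [ofReal_norm]
  refine (enorm_sum_le _ _).trans ?_
  refine le_trans (Finset.sum_le_sum fun k _ => ?_)
    (Finset.sum_le_sum_of_subset (Finset.range_subset_range.2 hnm))
  rw [intervalIntegral.integral_of_le
    (div_le_div_of_nonneg_right (by push_cast; linarith) (by positivity))]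
  exact enorm_integral_le_lintegral_enorm _

/-- The index of the last term of the Riemann sum matches `t` up to `O(2^{-J})`. -/
lemma riemann_index_bounds (J T : ℕ) {t : ℝ} (ht : t ∈ Set.Icc (0 : ℝ) T) :
    ⌊((2 : ℝ) ^ J - 1) * t⌋₊ + 1 ≤ (T + 1) * 2 ^ J ∧
      |t - ((⌊((2 : ℝ) ^ J - 1) * t⌋₊ + 1 : ℕ) : ℝ) / 2 ^ J| ≤ (T + 1) * (1 / 2 ^ J) := by
  have h1 : (1 : ℝ) ≤ 2 ^ J := one_le_pow₀ one_le_two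
  have h2 : 0 ≤ ((2 : ℝ) ^ J - 1) * t := mul_nonneg (by linarith) ht.1
  have h3 := Nat.floor_le h2
  have h4 := Nat.lt_floor_add_one (((2 : ℝ) ^ J - 1) * t)
  have ht0 := ht.1
  have htT := ht.2
  set N := ⌊((2 : ℝ) ^ J - 1) * t⌋₊
  constructor
  · have : ((N + 1 : ℕ) : ℝ) ≤ (((T + 1) * 2 ^ J : ℕ) : ℝ) := by
      push_cast
      nlinarith
    exact_mod_cast this
  · have : t - ((N + 1 : ℕ) : ℝ) / 2 ^ J = (2 ^ J * t - (N + 1)) * (1 / 2 ^ J) := by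
      push_cast
      field_simp
    rw [this, abs_mul, abs_of_pos (show (0 : ℝ) < 1 / 2 ^ J by positivity)]
    gcongr
    rw [abs_le]
    constructor <;> nlinarith

lemma abs_integral_sub_riemann_le {Ω : Type*} {W : ℝ → Ω → ℝ} {ω : Ω}
    (hW : Continuous fun t => W t ω) (Y : ℕ → Ω → ℝ) (J T : ℕ)
    (hfin : stepError W Y J ((T + 1) * 2 ^ J) ω ≠ ⊤) {t : ℝ} (ht : t ∈ Set.Icc (0 : ℝ) T) :
    |(∫ s in (0 : ℝ)..t, W s ω)
        - ∑ k ∈ Finset.range (⌊((2 : ℝ) ^ J - 1) * t⌋₊ + 1), Y k ω * (1 / 2 ^ J)|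
      ≤ (stepError W Y J ((T + 1) * 2 ^ J) ω).toReal
        + (dyadicMax W (T + 1) ω).toReal * ((T + 1) * (1 / 2 ^ J)) := by
  obtain ⟨hn, hdist⟩ := riemann_index_bounds J T ht
  set n := ⌊((2 : ℝ) ^ J - 1) * t⌋₊ + 1
  set r := (n : ℝ) / 2 ^ J with hr
  have hint (a b : ℝ) : IntervalIntegrable (fun s => W s ω) volume a b := hW.intervalIntegrable a b
  have hr0 : 0 ≤ r := by positivity
  have hrT : r ≤ T + 1 := by
    rw [hr, div_le_iff₀ (by positivity)]
    exact_mod_cast hn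
  have hsplit : (∫ s in (0 : ℝ)..t, W s ω)
      = (∫ s in (0 : ℝ)..r, W s ω) + ∫ s in r..t, W s ω :=
    (intervalIntegral.integral_add_adjacent_intervals (hint _ _) (hint _ _)).symm
  have htail : |∫ s in r..t, W s ω| ≤ (dyadicMax W (T + 1) ω).toReal * |t - r| := by
    rw [← Real.norm_eq_abs]
    refine intervalIntegral.norm_integral_le_of_norm_le_const fun s hs => ?_
    rw [Set.mem_uIoc] at hs
    have ht0 := ht.1
    have htT := ht.2
    refine norm_le_dyadicMax hW ?_ ?_ <;> rcases hs with hs | hs <;> linarith [hs.1, hs.2]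
  have hmain := abs_integral_sub_sum_le hW Y J hn hfin
  rw [hsplit, add_sub_right_comm]
  refine (abs_add_le _ _).trans (add_le_add hmain (htail.trans ?_))
  gcongr

end Pathwise

/-! ### From mean errors to almost sure rates -/

section Expectation

variable {Ω : Type*} [MeasurableSpace Ω] {P : Measure Ω}

lemma measurable_stepError {W : ℝ → Ω → ℝ} (hWm : ∀ t, Measurable (W t))
    (hWc : ∀ ω, Continuous fun t => W t ω) {Y : ℕ → Ω → ℝ} (hY : ∀ k, Measurable (Y k))
    (J n : ℕ) : Measurable (stepError W Y J n) := by
  have hW : Measurable fun q : Ω × ℝ => W q.2 q.1 :=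
    (measurable_uncurry_of_continuous_of_measurable (u := W) hWc hWm).comp measurable_swap
  refine Finset.measurable_fun_sum _ fun k _ => ?_
  exact Measurable.lintegral_prod_right
    (f := fun ω s => ‖W s ω - Y k ω‖ₑ) ((hW.sub ((hY k).comp measurable_fst)).enorm)

/-- Tonelli: the mean error is bounded at each time of a cell, and each cell has length `2^{-J}`. -/
lemma lintegral_stepError_le [SFinite P] {W : ℝ → Ω → ℝ} (hWm : ∀ t, Measurable (W t))
    (hWc : ∀ ω, Continuous fun t => W t ω) {Y : ℕ → Ω → ℝ} (hY : ∀ k, Measurable (Y k))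
    (J n : ℕ) {K : ENNReal}
    (hK : ∀ (k : ℕ) (s : ℝ), s ∈ Set.Ioc ((k : ℝ) / 2 ^ J) (((k + 1 : ℕ) : ℝ) / 2 ^ J) →
      ∫⁻ ω, ‖W s ω - Y k ω‖ₑ ∂P ≤ K) :
    ∫⁻ ω, stepError W Y J n ω ∂P ≤ n * (K * ENNReal.ofReal (1 / 2 ^ J)) := by
  have hW : Measurable fun q : Ω × ℝ => W q.2 q.1 :=
    (measurable_uncurry_of_continuous_of_measurable (u := W) hWc hWm).comp measurable_swap
  have hm (k : ℕ) : Measurable fun q : Ω × ℝ => ‖W q.2 q.1 - Y k q.1‖ₑ :=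
    (hW.sub ((hY k).comp measurable_fst)).enorm
  unfold stepError
  rw [lintegral_finsetSum _ fun k _ => Measurable.lintegral_prod_right (hm k)]
  refine (Finset.sum_le_sum (g := fun _ => K * ENNReal.ofReal (1 / 2 ^ J)) fun k _ => ?_).trans ?_
  · rw [lintegral_lintegral_swap (hm k).aemeasurable]
    refine (setLIntegral_mono' measurableSet_Ioc (hK k)).trans ?_
    rw [setLIntegral_const, Real.volume_Ioc]
    gcongr
    push_cast
    exact le_of_eq (by ring)
  · rw [Finset.sum_const, Finset.card_range, nsmul_eq_mul]

/-- A sequence of nonnegative variables whose means decay like `2^{-Jh}` is almost surely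
`O(2^{-Jν})` for `ν < h`. -/
lemma exists_measurable_bound_of_lintegral_le {D : ℕ → Ω → ENNReal} (hD : ∀ J, Measurable (D J))
    {K : ENNReal} (hK : K ≠ ⊤) {h ν : ℝ} (hν : ν < h)
    (hle : ∀ J : ℕ, ∫⁻ ω, D J ω ∂P ≤ K * ENNReal.ofReal (((2 : ℝ) ^ J) ^ (-h))) :
    ∃ S : Ω → ℝ, Measurable S ∧ ∀ᵐ ω ∂P, ∀ J : ℕ,
      D J ω ≠ ⊤ ∧ (D J ω).toReal ≤ S ω * (2 : ℝ) ^ (-(J : ℝ) * ν) := by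
  -- Its mean is dominated by a geometric series of ratio `2^{ν-h} < 1`; its almost surely finite
  -- value bounds every term.
  let S : Ω → ENNReal := fun ω => ∑' J : ℕ, ENNReal.ofReal ((2 : ℝ) ^ ((J : ℝ) * ν)) * D J ω
  have hSm : Measurable S := Measurable.tsum fun J => (hD J).const_mul _
  have hSint : ∫⁻ ω, S ω ∂P ≠ ⊤ := by
    have hterm (J : ℕ) : ∫⁻ ω, ENNReal.ofReal ((2 : ℝ) ^ ((J : ℝ) * ν)) * D J ω ∂P
        ≤ K * ENNReal.ofReal (((2 : ℝ) ^ (ν - h)) ^ J) := by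
      rw [lintegral_const_mul _ (hD J)]
      refine (mul_le_mul_right (hle J) _).trans_eq ?_
      rw [mul_left_comm, ← ENNReal.ofReal_mul (by positivity)]
      congr 2
      rw [← Real.rpow_natCast 2 J, ← Real.rpow_mul zero_le_two, ← Real.rpow_add two_pos,
        ← Real.rpow_natCast _ J, ← Real.rpow_mul zero_le_two]
      congr 1
      ring
    rw [lintegral_tsum fun J => ((hD J).const_mul _).aemeasurable]
    refine ne_top_of_le_ne_top ?_ (ENNReal.tsum_le_tsum hterm)
    rw [ENNReal.tsum_mul_left, ← ENNReal.ofReal_tsum_of_nonneg (fun n => by positivity)]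
    · exact ENNReal.mul_ne_top hK ENNReal.ofReal_ne_top
    · exact summable_geometric_of_lt_one (by positivity)
        (Real.rpow_lt_one_of_one_lt_of_neg one_lt_two (by linarith))
  refine ⟨fun ω => (S ω).toReal, hSm.ennreal_toReal, ?_⟩
  filter_upwards [ae_lt_top hSm hSint] with ω hω J
  have hJ : ENNReal.ofReal ((2 : ℝ) ^ ((J : ℝ) * ν)) * D J ω ≤ S ω :=
    ENNReal.le_tsum (f := fun J : ℕ => ENNReal.ofReal ((2 : ℝ) ^ ((J : ℝ) * ν)) * D J ω) J
  have h2 : (0 : ℝ) < (2 : ℝ) ^ ((J : ℝ) * ν) := by positivity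
  have hfin : D J ω ≠ ⊤ := by
    intro htop
    rw [htop, ENNReal.mul_top (by simpa using h2)] at hJ
    exact absurd (top_le_iff.1 hJ) hω.ne
  refine ⟨hfin, ?_⟩
  have h3 := ENNReal.toReal_mono hω.ne hJ
  rw [ENNReal.toReal_mul, ENNReal.toReal_ofReal h2.le] at h3
  rw [neg_mul, Real.rpow_neg zero_le_two, ← div_eq_mul_inv, le_div_iff₀ h2, mul_comm]
  exact h3

end Expectation

/-! ### Assembly of the error bound -/

section Main

variable {Ω : Type*} [MeasurableSpace Ω] {P : Measure Ω} [IsProbabilityMeasure P]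
  {B : Set ℝ → Ω → ℂ} {ghat uhat : ℝ → ℝ} {C d e : ℝ}
  {ξ : ℤ → Ω → ℝ} {ε : ℕ → ℤ → Ω → ℝ} {Vd : ℕ → ℤ → Ω → ℝ} {V : ℝ → Ω → ℝ}

/-- The triangle inequality through `V(k/2^J)`: a Hölder increment over at most one cell, then the
discretization error. -/
lemma exists_lintegral_error_le (hB : IsBrownianMeasure P B) (hg : IsRegularFilter ghat C d e)
    (hu : IsMeyerFilter uhat) (hV : IsVelocityProcess P B ghat V)
    (hD : IsDiscretization P B ghat uhat ξ ε Vd) {h : ℝ} (h0 : 0 ≤ h) (h1 : h ≤ 1)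
    (hd : h < d + 1 / 2) :
    ∃ K : ENNReal, K ≠ ⊤ ∧ ∀ (J k : ℕ) (s : ℝ),
      s ∈ Set.Ioc ((k : ℝ) / 2 ^ J) (((k + 1 : ℕ) : ℝ) / 2 ^ J) →
      ∫⁻ ω, ‖V s ω - (2 : ℝ) ^ ((J : ℝ) / 2) * Vd J (k : ℤ) ω‖ₑ ∂P
        ≤ K * ENNReal.ofReal (((2 : ℝ) ^ J) ^ (-h)) := by
  obtain ⟨K₁, hK₁, hinc⟩ := exists_eLpNorm_increment_le (p := 2) hB hg hV h0 h1 hd one_le_two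
    (by simp)
  obtain ⟨K₂, hK₂, hdis⟩ := exists_eLpNorm_discretization_le hB hg hu hV hD h0 hd
  refine ⟨K₁ + K₂, ENNReal.add_ne_top.2 ⟨hK₁, hK₂⟩, fun J k s hs => ?_⟩
  have hVm (t : ℝ) (ht : 0 ≤ t) : AEStronglyMeasurable (V t) P :=
    Complex.continuous_re.comp_aestronglyMeasurable (hV t ht).2.1.1
  have hk0 : 0 ≤ (k : ℝ) / 2 ^ J := by positivity
  have hs0 : 0 ≤ s := hk0.trans hs.1.le
  have hVdm : AEStronglyMeasurable (Vd J (k : ℤ)) P := by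
    obtain ⟨_, hY, _⟩ := hD.pairMem hB hg hu J k
    exact Complex.continuous_re.comp_aestronglyMeasurable hY.1
  have hm1 := (hVm s hs0).sub (hVm _ hk0)
  have hm2 := (hVm _ hk0).sub (hVdm.const_mul ((2 : ℝ) ^ ((J : ℝ) / 2)))
  have hfun : (fun ω => V s ω - (2 : ℝ) ^ ((J : ℝ) / 2) * Vd J (k : ℤ) ω)
      = (fun ω => V s ω - V ((k : ℝ) / 2 ^ J) ω)
        + fun ω => V ((k : ℝ) / 2 ^ J) ω - (2 : ℝ) ^ ((J : ℝ) / 2) * Vd J (k : ℤ) ω := by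
    ext ω
    simp
  rw [← eLpNorm_one_eq_lintegral_enorm, hfun]
  refine (eLpNorm_le_eLpNorm_of_exponent_le one_le_two (hm1.add hm2)).trans ?_
  refine (eLpNorm_add_le hm1 hm2 one_le_two).trans ?_
  rw [add_mul]
  refine add_le_add ((hinc _ _ hk0 hs0).trans ?_) (hdis J k)
  gcongr
  have hle : |s - (k : ℝ) / 2 ^ J| ≤ ((2 : ℝ) ^ J)⁻¹ := by
    have h2 := hs.2
    push_cast at h2
    rw [add_div, one_div] at h2
    rw [abs_of_nonneg (by linarith [hs.1])]
    linarith
  rw [Real.rpow_neg (by positivity), ← Real.inv_rpow (by positivity)]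
  gcongr

/-- The error bound for regular filters. -/
theorem exists_riemannSum_error_bound (hB : IsBrownianMeasure P B)
    (hg : IsRegularFilter ghat C d e) (hu : IsMeyerFilter uhat)
    (hV : IsVelocityProcess P B ghat V) (hD : IsDiscretization P B ghat uhat ξ ε Vd)
    {W : ℝ → Ω → ℝ} (hW : IsContinuousVersion P V W) {ν : ℝ} (hν0 : 0 ≤ ν) (hν1 : ν < 1)
    (hνd : ν < d + 1 / 2) (T : ℕ) :
    ∃ A : Ω → ℝ, Measurable A ∧ ∀ᵐ ω ∂P, ∀ J : ℕ, ∀ t ∈ Set.Icc (0 : ℝ) T,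
      |position W t ω - riemannSum Vd J t ω| ≤ A ω * (2 : ℝ) ^ (-(J : ℝ) * ν) := by
  obtain ⟨U, hUm, hUc, hUV⟩ := hV.exists_continuous_modification hB hg
  -- The gap between `ν` and `h` pays for the summation over `J`.
  obtain ⟨h, hνh, hh⟩ := exists_between (lt_min hν1 hνd)
  have hh1 : h < 1 := hh.trans_le (min_le_left _ _)
  have hhd : h < d + 1 / 2 := hh.trans_le (min_le_right _ _)
  obtain ⟨K, hK, herr⟩ := exists_lintegral_error_le hB hg hu hV hD (hν0.trans hνh.le) hh1.le hhd
  have hVdm (J k : ℕ) : AEMeasurable (Vd J (k : ℤ)) P := by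
    obtain ⟨_, hY, _⟩ := hD.pairMem hB hg hu J k
    exact Complex.measurable_re.comp_aemeasurable hY.1.aemeasurable
  let Y : ℕ → ℕ → Ω → ℝ := fun J k ω => (2 : ℝ) ^ ((J : ℝ) / 2) * (hVdm J k).mk _ ω
  have hYm (J k : ℕ) : Measurable (Y J k) := (hVdm J k).measurable_mk.const_mul _
  have hYV (J k : ℕ) : (fun ω => (2 : ℝ) ^ ((J : ℝ) / 2) * Vd J (k : ℤ) ω) =ᵐ[P] Y J k := by
    filter_upwards [(hVdm J k).ae_eq_mk] with ω hω
    simp only [Y, ← hω]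
  have hmean (J : ℕ) : ∫⁻ ω, stepError U (Y J) J ((T + 1) * 2 ^ J) ω ∂P
      ≤ ((T + 1 : ℕ) * K) * ENNReal.ofReal (((2 : ℝ) ^ J) ^ (-h)) := by
    refine (lintegral_stepError_le hUm hUc (hYm J) J _
      (K := K * ENNReal.ofReal (((2 : ℝ) ^ J) ^ (-h))) fun k s hs => ?_).trans_eq ?_
    · refine le_of_eq_of_le (lintegral_congr_ae ?_) (herr J k s hs)
      have hs0 : 0 ≤ s := (show 0 ≤ (k : ℝ) / 2 ^ J by positivity).trans hs.1.le
      filter_upwards [hUV s hs0, hYV J k] with ω h2 h3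
      rw [h2, ← h3]
    -- The number of cells per unit of time cancels their length.
    · have h2 : ((2 : ENNReal) ^ J) * ENNReal.ofReal (1 / 2 ^ J) = 1 := by
        rw [one_div, ENNReal.ofReal_inv_of_pos (by positivity), ENNReal.ofReal_pow zero_le_two,
          ENNReal.ofReal_ofNat]
        exact ENNReal.mul_inv_cancel (by simp) (by simp)
      push_cast
      calc ((T : ENNReal) + 1) * 2 ^ J *
            (K * ENNReal.ofReal (((2 : ℝ) ^ J) ^ (-h)) * ENNReal.ofReal (1 / 2 ^ J))
          = ((T : ENNReal) + 1) * K * ENNReal.ofReal (((2 : ℝ) ^ J) ^ (-h)) *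
            (2 ^ J * ENNReal.ofReal (1 / 2 ^ J)) := by ring
        _ = _ := by rw [h2, mul_one]
  obtain ⟨S, hSm, hS⟩ := exists_measurable_bound_of_lintegral_le
    (fun J => measurable_stepError hUm hUc (hYm J) J ((T + 1) * 2 ^ J))
    (ENNReal.mul_ne_top (by simp) hK) hνh hmean
  -- The second term pays for the mismatch between `t` and the last grid point; as a countable
  -- supremum, the maximum is measurable.
  refine ⟨fun ω => S ω + (dyadicMax U (T + 1) ω).toReal * (T + 1),
    hSm.add ((measurable_dyadicMax hUm _).ennreal_toReal.mul_const _), ?_⟩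
  have hWU := ae_eq_of_continuousOn
    (fun t ht => (hW.1 t ht).trans (hUV t ht).symm) hW.2 hUc
  have hYall : ∀ᵐ ω ∂P, ∀ J k : ℕ, (2 : ℝ) ^ ((J : ℝ) / 2) * Vd J (k : ℤ) ω = Y J k ω :=
    ae_all_iff.2 fun J => ae_all_iff.2 fun k => hYV J k
  filter_upwards [hS, hWU, hYall] with ω hSω hWω hYω J t ht
  have hpos : position W t ω = ∫ s in (0 : ℝ)..t, U s ω := by
    refine intervalIntegral.integral_congr fun s hs => ?_
    rw [Set.uIcc_of_le ht.1] at hs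
    exact hWω s hs.1
  have hsum : riemannSum Vd J t ω
      = ∑ k ∈ Finset.range (⌊((2 : ℝ) ^ J - 1) * t⌋₊ + 1), Y J k ω * (1 / 2 ^ J) :=
    Finset.sum_congr rfl fun k _ => by rw [hYω]
  rw [hpos, hsum]
  refine (abs_integral_sub_riemann_le (hUc ω) (Y J) J T (hSω J).1 ht).trans ?_
  -- The endpoint term is of order `2^{-J}`, absorbed because `ν < 1`.
  have hpow : (1 : ℝ) / 2 ^ J ≤ (2 : ℝ) ^ (-(J : ℝ) * ν) := by
    rw [one_div, ← Real.rpow_natCast 2 J, ← Real.rpow_neg zero_le_two]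
    refine Real.rpow_le_rpow_of_exponent_le one_le_two ?_
    have : (0 : ℝ) ≤ J := Nat.cast_nonneg J
    nlinarith
  refine (add_le_add (hSω J).2 ?_).trans_eq (add_mul _ _ _).symm
  rw [mul_assoc]
  gcongr

end Main

end AnomalousDiffusion

end

theorem corollary1 (ghat : ℝ → ℝ) (hg : AnomalousDiffusion.IsVelocityFilter ghat) :
    ∃ ν : ℝ, 0 < ν ∧ ν < 1 ∧
      ∀ (uhat : ℝ → ℝ), AnomalousDiffusion.IsMeyerFilter uhat →
      ∀ (Ω : Type*) [MeasurableSpace Ω] (P : Measure Ω) [IsProbabilityMeasure P]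
        (B : Set ℝ → Ω → ℂ), AnomalousDiffusion.IsBrownianMeasure P B →
      ∀ (V : ℝ → Ω → ℝ), AnomalousDiffusion.IsVelocityProcess P B ghat V →
      (∃ W : ℝ → Ω → ℝ, AnomalousDiffusion.IsContinuousVersion P V W) ∧
      ∀ (W : ℝ → Ω → ℝ), AnomalousDiffusion.IsContinuousVersion P V W →
      ∀ (ξ : ℤ → Ω → ℝ) (ε : ℕ → ℤ → Ω → ℝ) (Vd : ℕ → ℤ → Ω → ℝ),
        AnomalousDiffusion.IsDiscretization P B ghat uhat ξ ε Vd →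
      ∀ T : ℕ, ∃ A' : Ω → ℝ, Measurable A' ∧
        ∀ᵐ ω ∂P, ∀ J : ℕ, ∀ t ∈ Set.Icc (0 : ℝ) T,
          |AnomalousDiffusion.position W t ω - AnomalousDiffusion.riemannSum Vd J t ω|
            ≤ A' ω * (2 : ℝ) ^ (-(J : ℝ) * ν) := by
  obtain ⟨C, d, e, hreg⟩ := hg.exists_isRegularFilter
  have hd1 := hreg.neg_half_lt
  have hd2 := hreg.lt_half
  -- Any exponent in `(0, d + 1/2)` below `1` would serve; the midpoint of that interval is below
  -- `1/2` and depends only on the filter.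
  refine ⟨(d + 1 / 2) / 2, by linarith, by linarith, fun uhat hu Ω _ P _ B hB V hV => ⟨?_, ?_⟩⟩
  · obtain ⟨W, -, hWc, hWV⟩ := hV.exists_continuous_modification hB hreg
    exact ⟨W, hWV, ae_of_all _ fun ω => (hWc ω).continuousOn⟩
  · intro W hW ξ ε Vd hD T
    exact AnomalousDiffusion.exists_riemannSum_error_bound hB hreg hu hV hD hW (by linarith)
      (by linarith) (by linarith) T
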